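/- Let $(b_i)_i,(h_i)_i$ be positive loss weights, and let $(\sigma_{p,i})_i,(\sigma_{f,i})_i$ be positive variances. Put $\tilde b_i=b_i/(b_i+h_i)$, and let $\phi,\Phi,\Phi^{-1}$ be the standard normal density, distribution function and quantile function. Assume (A1) $0<\inf_i\tilde b_i\le\sup_i\tilde b_i<1$ and $\sup_i(b_i+h_i)<\infty$; (A3) $\sup_i\sigma_{p,i}/\sigma_{f,i}<1/(4e)$, $\sup_i\sigma_{f,i}<\infty$ and $\inf_i\sigma_{p,i}>0$. Let $G(w,\beta)=\phi(w)+w\Phi(w)-\beta w$. For $\tau\in[0,\infty]$ let $\alpha_i(\tau)=\tau/(\tau+\sigma_{p,i})$, with $\alpha_i(\infty)=1$, and $$c_i(\tau)=\sqrt{\frac{\sigma_{f,i}+\alpha_i(\tau)\sigma_{p,i}}{\sigma_{f,i}+\alpha_i(\tau)^2\sigma_{p,i}}}\;\Phi^{-1}(\tilde b_i),\qquad d_i(\tau)=-\frac{1-\alpha_i(\tau)}{\sqrt{\sigma_{f,i}+\sigma_{p,i}\alpha_i(\tau)^2}} .$$ Let $X_i\sim N(\theta_i,\sigma_{p,i})$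 (variance $\sigma_{p,i}$) and $Z_i\sim N(0,1)$ be independent, and set $$U_i(\tau)=c_i(\tau)+d_i(\tau)(X_i+\sqrt{\sigma_{p,i}}Z_i),\qquad V_i(\tau)=c_i(\tau)+d_i(\tau)(X_i-\sqrt{\sigma_{p,i}}Z_i),\qquad v_i(\tau)=2\sigma_{p,i}d_i(\tau)^2 .$$ Fix any $\gamma(i)$ with $0<\gamma(i)<1/\sqrt{4e}-\sqrt{\sigma_{p,i}/\sigma_{f,i}}$. For $n\ge1$ put $$\lambda_n(i)=\gamma(i)\sqrt{2\log n},\qquad K_n(i)=1+\Big\lceil e^2\big(\gamma(i)+\sqrt{2\sigma_{p,i}/\sigma_{f,i}}\big)^2\,2\log n\Big\rceil .$$ With $H_k$ the probabilists' Hermite polynomials and $G'$ the derivative of $G$ in its first argument, let $$S_i(u)=G(0,\tilde b_i)+G'(0,\tilde b_i)u+\phi(0)\sum_{k=0}^{K_n(i)-2}\frac{(-1)^kH_k(0)}{(k+2)!}\,v_i(\tau)^{(k+2)/2}H_{k+2}\!\Big(\frac{u}{\sqrt{v_i(\tau)}}\Big),$$ where at $v_i(\tau)=0$ (that is, $\tau=\infty$)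 the expression $v^{m/2}H_m(u/\sqrt v)$ is read as its limit $u^m$. Let $\tilde S_i(u)=\operatorname{sign}(S_i(u))\min\{|S_i(u)|,n\}$ and $$\hat T_i(X_i,Z_i,\tau)=\begin{cases}-\tilde b_iU_i(\tau)&\text{if }V_i(\tau)<-\lambda_n(i),\\ \tilde S_i(U_i(\tau))&\text{if }-\lambda_n(i)\le V_i(\tau)\le\lambda_n(i),\\ (1-\tilde b_i)U_i(\tau)&\text{if }V_i(\tau)>\lambda_n(i).\end{cases}$$ Write $\mathrm{Bias}_{\theta_i}(\hat T_i)=\mathbb E\,\hat T_i(X_i,Z_i,\tau)-G(c_i(\tau)+d_i(\tau)\theta_i,\tilde b_i)$ and $a_n=\log\log n$. Then for every coordinate $i$, the estimate $\hat T_i(X_i,Z_i,\tau)$ is square integrable for all $n,\tau,\theta_i$, and $$\lim_{n\to\infty}\ \sup_{\tau\in[0,\infty],\,\theta_i\in\mathbb R}a_n^8\,\big|\mathrm{Bias}_{\theta_i}(\hat T_i(X_i,Z_i,\tau))\big|=0,\qquad \lim_{n\to\infty}\ \sup_{\tau\in[0,\infty],\,\theta_i\in\mathbb R}n^{-1}a_n^8\,\mathrm{Var}_{\theta_i}(\hat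 T_i(X_i,Z_i,\tau))=0 .$$ -/

import Mathlib

open MeasureTheory ProbabilityTheory Filter Topology
open scoped ENNReal NNReal

noncomputable section

namespace CheckLoss

/-- Standard normal density `φ`. -/
def stdPDF (w : ℝ) : ℝ := gaussianPDFReal 0 1 w

/-- Standard normal distribution function `Φ`. -/
def stdCDF (w : ℝ) : ℝ := cdf (gaussianReal 0 1) w

/-- Standard normal quantile function `Φ⁻¹`. -/
def stdQuantile (p : ℝ) : ℝ := sInf {x : ℝ | p ≤ stdCDF x}

/-- `G(w, β) = φ(w) + w Φ(w) - β w`. -/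
def G (w β : ℝ) : ℝ := stdPDF w + w * stdCDF w - β * w

/-- `b̃ = b / (b + h)`. -/
def bTilde (b h : ℝ) : ℝ := b / (b + h)

/-- The shrinkage factor `α(τ) = τ / (τ + σp)` for `τ ∈ [0, ∞]`, with `α(∞) = 1`. -/
def shrink (σp : ℝ) (τ : ℝ≥0∞) : ℝ :=
  if τ = ⊤ then 1 else τ.toReal / (τ.toReal + σp)

/-- The intercept `c(τ)` of the coordinatewise risk. -/
def coefC (σp σf β : ℝ) (τ : ℝ≥0∞) : ℝ :=
  √((σf + shrink σp τ * σp) / (σf + shrink σp τ ^ 2 * σp)) * stdQuantile β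

/-- The slope `d(τ)` of the coordinatewise risk. -/
def coefD (σp σf : ℝ) (τ : ℝ≥0∞) : ℝ :=
  -((1 - shrink σp τ) / √(σf + σp * shrink σp τ ^ 2))

/-- Value of the `k`-th probabilists' Hermite polynomial at `x`. -/
def hermiteVal (k : ℕ) (x : ℝ) : ℝ := Polynomial.aeval x (Polynomial.hermite k)

/-- `v^{k/2} H_k(x / √v)` for a variance `v > 0`, extended to `v = 0` by its limit `x ^ k`
(the case `v = 0` occurs exactly at `τ = ∞`, where `d(τ) = 0`). -/
def scaledHermite (k : ℕ) (v x : ℝ) : ℝ :=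
  if v = 0 then x ^ k else √v ^ k * hermiteVal k (x / √v)

/-- The truncation order `K_n`. -/
def truncOrder (γ σp σf : ℝ) (n : ℕ) : ℕ :=
  1 + ⌈Real.exp 1 ^ 2 * (γ + √(2 * σp / σf)) ^ 2 * (2 * Real.log n)⌉₊

/-- The threshold `λ_n = γ √(2 log n)`. -/
def threshold (γ : ℝ) (n : ℕ) : ℝ := γ * √(2 * Real.log n)

/-- The estimate `S(u)`, for `u` drawn with variance `2 σp d(τ)²`; the sum is over
`k = 0, …, K_n - 2`. -/
def seriesEst (γ σp σf β : ℝ) (n : ℕ) (τ : ℝ≥0∞) (u : ℝ) : ℝ :=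
  G 0 β + deriv (fun w => G w β) 0 * u
    + stdPDF 0 * ∑ k ∈ Finset.range (truncOrder γ σp σf n - 1),
        (-1) ^ k * hermiteVal k 0 / ((k + 2).factorial : ℝ)
          * scaledHermite (k + 2) (2 * σp * coefD σp σf τ ^ 2) u

/-- The estimate `S̃(u)`: `S(u)` truncated at absolute value `n`. -/
def truncEst (γ σp σf β : ℝ) (n : ℕ) (τ : ℝ≥0∞) (u : ℝ) : ℝ :=
  Real.sign (seriesEst γ σp σf β n τ u) * min |seriesEst γ σp σf β n τ u| (n : ℝ)

/-- `U(τ) = c(τ) + d(τ) (x + √σp z)`. -/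
def splitU (σp σf β : ℝ) (τ : ℝ≥0∞) (x z : ℝ) : ℝ :=
  coefC σp σf β τ + coefD σp σf τ * (x + √σp * z)

/-- `V(τ) = c(τ) + d(τ) (x - √σp z)`. -/
def splitV (σp σf β : ℝ) (τ : ℝ≥0∞) (x z : ℝ) : ℝ :=
  coefC σp σf β τ + coefD σp σf τ * (x - √σp * z)

/-- The randomized threshold estimate `T̂(x, z, τ)` of one coordinate, in dimension `n`. -/
def thresholdEst (γ σp σf β : ℝ) (n : ℕ) (τ : ℝ≥0∞) (x z : ℝ) : ℝ :=
  if splitV σp σf β τ x z < -threshold γ n then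
    -(β * splitU σp σf β τ x z)
  else if splitV σp σf β τ x z ≤ threshold γ n then
    truncEst γ σp σf β n τ (splitU σp σf β τ x z)
  else
    (1 - β) * splitU σp σf β τ x z

/-- Joint law of `(X, Z)` in one coordinate: independent, `X ∼ N(θ, σp)` (variance `σp`) and
`Z ∼ N(0, 1)`. -/
def coordLaw (σp θ : ℝ) : Measure (ℝ × ℝ) :=
  (gaussianReal θ σp.toNNReal).prod (gaussianReal 0 1)

/-- The estimand `G(c(τ) + d(τ) θ, β)`. -/
def target (σp σf β : ℝ) (τ : ℝ≥0∞) (θ : ℝ) : ℝ :=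
  G (coefC σp σf β τ + coefD σp σf τ * θ) β

/-- Bias of `T̂(X, Z, τ)` as an estimate of `G(c(τ) + d(τ) θ, β)`. -/
def bias (γ σp σf β : ℝ) (n : ℕ) (τ : ℝ≥0∞) (θ : ℝ) : ℝ :=
  (∫ p, thresholdEst γ σp σf β n τ p.1 p.2 ∂(coordLaw σp θ)) - target σp σf β τ θ

/-- Variance of `T̂(X, Z, τ)`. -/
def estVar (γ σp σf β : ℝ) (n : ℕ) (τ : ℝ≥0∞) (θ : ℝ) : ℝ :=
  variance (fun p : ℝ × ℝ => thresholdEst γ σp σf β n τ p.1 p.2) (coordLaw σp θ)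

/-- `a_n = log log n`. -/
def rate (n : ℕ) : ℝ := Real.log (Real.log n)

/-- Bounded weights of the loss function: `0 < inf b̃_i`, `sup b̃_i < 1`, `sup (b_i + h_i) < ∞`. -/
def BoundedWeights (b h : ℕ → ℝ) : Prop :=
  (∃ lo > 0, ∀ i, lo ≤ bTilde (b i) (h i)) ∧
  (∃ hi < 1, ∀ i, bTilde (b i) (h i) ≤ hi) ∧
  (∃ M, ∀ i, b i + h i ≤ M)

/-- Sufficient historical data: `sup σp_i / σf_i < 1 / (4e)`, `sup σf_i < ∞`, `inf σp_i > 0`. -/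
def SufficientHistory (σp σf : ℕ → ℝ) : Prop :=
  (∃ r < 1 / (4 * Real.exp 1), ∀ i, σp i / σf i ≤ r) ∧
  (∃ M, ∀ i, σf i ≤ M) ∧
  (∃ m > 0, ∀ i, m ≤ σp i)

end CheckLoss

end

noncomputable section

namespace CheckLoss

/-! The pair (U, V) is jointly normal and uncorrelated, so U and V are independent with a common law
N(μ, v), where μ = c + dθ and v ≤ w = 2σp/σf. The condition on γ gives γ² ≤ 1/(4e) ≤ 1/10 and w ≤
1/5. The parameters τ and θ enter only through μ and v, so bounds uniform in real μ and v ≤ w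
suffice.

By independence, the bias is a sum over the three ranges of V of P(V in the range) times the
conditional error. In the outer ranges the error is ±(φ + μΦ) or its reflection. It is large only
where Chebyshev makes the range unlikely, which leaves O(1/λ) (`tail_term_le`).

In the central range, Stein's identity makes the variance-v Hermite polynomial P_k an unbiased
estimate of μ^k, so E S(U) is a Taylor polynomial of G at μ. Its remainder is small for |μ| ≤ λ + D,
with D = √w √(2 log n), because K_n is about e²(λ + D)² (`abs_sum_taylorCoef_sub_G_le`). For larger
|μ| the central range has probability at most 1/n (`central_far_le`). Truncation at n costs at most
E S²/n.

Second moments are controlled by E P_k² ≤ k! exp(μ²/(1-v)) (`integral_scaledHermitePoly_sq_le`). The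
exponential growth in μ is absorbed by P(|V| ≤ λ): the product is at most exp(5λ²/2) ≤ n^{1/2}
(`gaussianReal_Icc_mul_exp_le`). Up to powers of log n, this bounds the truncation bias by n^{-1/2}
and the variance divided by n by n^{-1/2}. The slowest term overall is (log n)^{-1/2}, which still
beats (log log n)^8. -/

open Polynomial in
/-- The Hermite polynomials `P_m` of variance `v`, given by `P_{m+1} = X P_m - v P_m'`. -/
def scaledHermitePoly (v : ℝ) : ℕ → ℝ[X]
  | 0 => 1
  | m + 1 => X * scaledHermitePoly v m - C v * derivative (scaledHermitePoly v m)

/-! ### Splitting one normal observation into two independent ones. -/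

instance isGaussian_coordLaw (σp θ : ℝ) : IsGaussian (coordLaw σp θ) := by
  unfold coordLaw; infer_instance

lemma map_fst_coordLaw (σp θ : ℝ) :
    (coordLaw σp θ).map Prod.fst = gaussianReal θ σp.toNNReal := by
  simp [coordLaw]

lemma map_snd_coordLaw (σp θ : ℝ) : (coordLaw σp θ).map Prod.snd = gaussianReal 0 1 := by
  simp [coordLaw]

lemma map_sqrt_mul_snd_coordLaw {σp : ℝ} (hσ : 0 < σp) (θ s : ℝ) (hs : s ^ 2 = σp) :
    (coordLaw σp θ).map (fun p => s * p.2) = gaussianReal 0 σp.toNNReal := by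
  have h : (fun p : ℝ × ℝ => s * p.2) = (fun x => s * x) ∘ Prod.snd := rfl
  rw [h, ← Measure.map_map (by fun_prop) (by fun_prop), map_snd_coordLaw,
    gaussianReal_map_const_mul]
  congr 1
  · simp
  · ext; simp [hs, hσ.le]

lemma indepFun_fst_mul_snd (σp θ s : ℝ) :
    IndepFun (fun p : ℝ × ℝ => p.1) (fun p => s * p.2) (coordLaw σp θ) :=
  indepFun_prod (X := fun x : ℝ => x) (Y := fun z => s * z) measurable_id (by fun_prop)

/-- Only s² is fixed, so s = √σp serves U and s = -√σp serves V. -/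
lemma map_add_mul_coordLaw {σp : ℝ} (hσ : 0 < σp) (θ s : ℝ) (hs : s ^ 2 = σp) :
    (coordLaw σp θ).map (fun p => p.1 + s * p.2) = gaussianReal θ (2 * σp).toNNReal := by
  have h := gaussianReal_add_gaussianReal_of_indepFun (indepFun_fst_mul_snd σp θ s)
    (map_fst_coordLaw σp θ) (map_sqrt_mul_snd_coordLaw hσ θ s hs)
  have e : (2 * σp).toNNReal = σp.toNNReal + σp.toNNReal := by
    rw [two_mul, Real.toNNReal_add hσ.le hσ.le]
  have e' : (fun p : ℝ × ℝ => p.1 + s * p.2) = (fun p => p.1) + fun p => s * p.2 := rfl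
  rw [e, e']
  simpa using h

/-- The cross terms cancel and Var X - Var(sZ) = σp - σp: the added noise is scaled to have the
variance of X. -/
lemma covariance_add_sub_coordLaw {σp : ℝ} (hσ : 0 < σp) (θ s : ℝ) (hs : s ^ 2 = σp) :
    cov[fun p : ℝ × ℝ => p.1 + s * p.2, fun p => p.1 - s * p.2; coordLaw σp θ] = 0 := by
  have hX : MemLp (fun p : ℝ × ℝ => p.1) 2 (coordLaw σp θ) :=
    HasGaussianLaw.memLp_two (IsGaussian.hasGaussianLaw_id.map_fun (ContinuousLinearMap.fst ℝ ℝ ℝ))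
  have hZ : MemLp (fun p : ℝ × ℝ => s * p.2) 2 (coordLaw σp θ) :=
    (HasGaussianLaw.memLp_two
      (IsGaussian.hasGaussianLaw_id.map_fun (ContinuousLinearMap.snd ℝ ℝ ℝ))).const_mul s
  have h1 : Var[fun p : ℝ × ℝ => p.1; coordLaw σp θ] = σp := by
    have := variance_map (μ := coordLaw σp θ) (X := id) (Y := Prod.fst) (by fun_prop) (by fun_prop)
    rw [map_fst_coordLaw, variance_id_gaussianReal] at this
    simpa [hσ.le] using this.symm
  have h2 : Var[fun p : ℝ × ℝ => s * p.2; coordLaw σp θ] = σp := by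
    have := variance_map (μ := coordLaw σp θ) (X := id) (Y := fun p => s * p.2) (by fun_prop)
      (by fun_prop)
    rw [map_sqrt_mul_snd_coordLaw hσ θ s hs, variance_id_gaussianReal] at this
    simpa [hσ.le] using this.symm
  have e1 : (fun p : ℝ × ℝ => p.1 + s * p.2) = (fun p => p.1) + fun p => s * p.2 := rfl
  have e2 : (fun p : ℝ × ℝ => p.1 - s * p.2) = (fun p => p.1) - fun p => s * p.2 := rfl
  rw [e1, e2, covariance_sub_right (hX.add hZ) hX hZ, covariance_add_left hX hZ hX,
    covariance_add_left hX hZ hZ, covariance_self (by fun_prop), covariance_self (by fun_prop),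
    covariance_comm, h1, h2]
  ring

/-- `U` and `V` are independent with the same normal law. -/
theorem map_split_coordLaw {σp : ℝ} (hσ : 0 < σp) (θ c d : ℝ) :
    (coordLaw σp θ).map
      (fun p => (c + d * (p.1 + √σp * p.2), c + d * (p.1 - √σp * p.2))) =
    (gaussianReal (c + d * θ) (2 * σp * d ^ 2).toNNReal).prod
      (gaussianReal (c + d * θ) (2 * σp * d ^ 2).toNNReal) := by
  have hs : √σp ^ 2 = σp := Real.sq_sqrt hσ.le
  have hs' : (-√σp) ^ 2 = σp := by rw [neg_sq, hs]
  have hind : IndepFun (fun p : ℝ × ℝ => p.1 + √σp * p.2) (fun p => p.1 - √σp * p.2)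
      (coordLaw σp θ) := by
    refine HasGaussianLaw.indepFun_of_covariance_eq_zero ?_
      (covariance_add_sub_coordLaw hσ θ _ hs)
    exact IsGaussian.hasGaussianLaw_id.map_fun
      ((ContinuousLinearMap.fst ℝ ℝ ℝ + √σp • ContinuousLinearMap.snd ℝ ℝ ℝ).prod
        (ContinuousLinearMap.fst ℝ ℝ ℝ - √σp • ContinuousLinearMap.snd ℝ ℝ ℝ))
  have hlaw : ∀ s : ℝ, s ^ 2 = σp → (coordLaw σp θ).map (fun p => c + d * (p.1 + s * p.2)) =
      gaussianReal (c + d * θ) (2 * σp * d ^ 2).toNNReal := by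
    intro s hs
    have h := gaussianReal_const_add (gaussianReal_const_mul
      (X := fun p : ℝ × ℝ => p.1 + s * p.2) ⟨by fun_prop, map_add_mul_coordLaw hσ θ s hs⟩ d) c
    rw [h.map_eq]
    congr 1
    · ring
    · ext
      have : 0 ≤ σp * d ^ 2 := by positivity
      simp [hσ.le, mul_assoc, this]
      ring
  have hcomp := hind.comp (φ := fun x => c + d * x) (ψ := fun x => c + d * x) (by fun_prop)
    (by fun_prop)
  have := hcomp.map_prod_eq_prod_map_map (by fun_prop) (by fun_prop)
  simp only [Function.comp_def] at this
  rw [this, hlaw _ hs]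
  have h2 := hlaw _ hs'
  simp only [neg_mul, ← sub_eq_add_neg] at h2
  rw [h2]

/-! ### Hermite polynomials of variance v under a normal law. -/

section HermitePolynomials

open Polynomial

lemma integrable_eval_gaussianReal (μ : ℝ) (v : ℝ≥0) (p : ℝ[X]) :
    Integrable (fun x => p.eval x) (gaussianReal μ v) := by
  induction p using Polynomial.induction_on' with
  | add p q hp hq => simpa only [eval_add] using hp.fun_add hq
  | monomial n a =>
    simp only [eval_monomial]
    refine Integrable.const_mul ?_ a
    have h := (memLp_id_gaussianReal' (μ := μ) (v := v) n (by simp)).integrable_norm_pow' 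
    refine (integrable_norm_iff (by fun_prop)).1 ?_
    simpa using h

lemma hasDerivAt_gaussianPDFReal (μ : ℝ) (v : ℝ≥0) (hv : v ≠ 0) (x : ℝ) :
    HasDerivAt (gaussianPDFReal μ v) (-((x - μ) / v) * gaussianPDFReal μ v x) x := by
  have hv' : (v : ℝ) ≠ 0 := by simpa using hv
  have h1 : HasDerivAt (fun x : ℝ => -(x - μ) ^ 2 / (2 * v)) (-((x - μ) / v)) x := by
    have := ((((hasDerivAt_id x).sub_const μ).pow 2).neg).div_const (2 * (v : ℝ))
    refine this.congr_deriv ?_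
    simp
    field_simp
  refine (h1.exp.const_mul (√(2 * Real.pi * v))⁻¹).congr_deriv ?_
  rw [gaussianPDFReal]
  ring

lemma integrable_gaussianPDFReal_mul_eval (μ : ℝ) (v : ℝ≥0) (hv : v ≠ 0) (p : ℝ[X]) :
    Integrable (fun x => gaussianPDFReal μ v x * p.eval x) := by
  have h := integrable_eval_gaussianReal μ v p
  rw [gaussianReal_of_var_ne_zero _ hv,
    integrable_withDensity_iff_integrable_smul' (measurable_gaussianPDF _ _)
      (ae_of_all _ fun _ => gaussianPDF_lt_top)] at h
  simpa [toReal_gaussianPDF] using h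

/-- Stein's identity for polynomials. -/
theorem integral_sub_mul_eval_gaussianReal (μ : ℝ) (v : ℝ≥0) (p : ℝ[X]) :
    ∫ x, (x - μ) * p.eval x ∂gaussianReal μ v =
      v * ∫ x, (derivative p).eval x ∂gaussianReal μ v := by
  rcases eq_or_ne v 0 with rfl | hv
  · simp [gaussianReal_zero_var]
  have hv' : (v : ℝ) ≠ 0 := by simpa using hv
  rw [integral_gaussianReal_eq_integral_smul hv, integral_gaussianReal_eq_integral_smul hv]
  -- Integration by parts, using that the density f satisfies f' = -((x - μ)/v) f.
  have h := integral_mul_deriv_eq_deriv_mul_of_integrable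
    (u := fun x => p.eval x) (v := gaussianPDFReal μ v)
    (u' := fun x => (derivative p).eval x)
    (v' := fun x => -((x - μ) / v) * gaussianPDFReal μ v x)
    (fun x _ => p.hasDerivAt x) (fun x _ => hasDerivAt_gaussianPDFReal μ v hv x)
    (by
      refine ((integrable_gaussianPDFReal_mul_eval μ v hv ((X - C μ) * p)).const_mul
        (-(v : ℝ)⁻¹)).congr (ae_of_all _ fun x => ?_)
      simp; ring)
    (by
      refine (integrable_gaussianPDFReal_mul_eval μ v hv (derivative p)).congr
        (ae_of_all _ fun x => ?_)
      simp; ring)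
    (by
      refine (integrable_gaussianPDFReal_mul_eval μ v hv p).congr
        (ae_of_all _ fun x => ?_)
      simp; ring)
  have h1 : ∫ x, gaussianPDFReal μ v x • ((x - μ) * p.eval x) =
      -v * ∫ x, p.eval x * (-((x - μ) / v) * gaussianPDFReal μ v x) := by
    rw [← integral_const_mul]
    congr 1; ext x
    simp; field_simp
  rw [h1, h, neg_mul_neg]
  congr 2; ext x; simp [mul_comm]

@[simp] lemma derivative_scaledHermitePoly (v : ℝ) (m : ℕ) :
    derivative (scaledHermitePoly v (m + 1)) = C ((m : ℝ) + 1) * scaledHermitePoly v m := by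
  induction m with
  | zero => simp [scaledHermitePoly]
  | succ m ih =>
    rw [scaledHermitePoly, derivative_sub, derivative_mul, derivative_X, derivative_mul,
      derivative_C, ih, derivative_mul, derivative_C]
    conv_rhs => rw [scaledHermitePoly]
    conv_lhs => rw [scaledHermitePoly]
    simp only [Nat.cast_add, Nat.cast_one, C_add, C_1]
    ring

lemma iterate_derivative_scaledHermitePoly (v : ℝ) (m j : ℕ) (hj : j ≤ m) :
    derivative^[j] (scaledHermitePoly v m) =
      C (m.descFactorial j : ℝ) * scaledHermitePoly v (m - j) := by
  induction j with
  | zero => simp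
  | succ j ih =>
    rw [Function.iterate_succ_apply', ih (by omega), derivative_mul, derivative_C, zero_mul, zero_add]
    obtain ⟨k, rfl⟩ := Nat.exists_eq_add_of_le hj
    have e1 : j + 1 + k - j = k + 1 := by omega
    have e2 : j + 1 + k - (j + 1) = k := by omega
    rw [e1, e2, derivative_scaledHermitePoly, ← mul_assoc, ← C_mul, Nat.descFactorial_succ, e1]
    push_cast
    ring_nf

/-- Rescaling the recursion H_{m+1} = X H_m - H_m' by s turns it into the recursion with v = s². -/
lemma comp_hermite_recursion {s : ℝ} (hs : s ≠ 0) (m : ℕ) :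
    scaledHermitePoly (s ^ 2) m =
      C (s ^ m) * ((hermite m).map (Int.castRingHom ℝ)).comp (C s⁻¹ * X) := by
  induction m with
  | zero => simp [scaledHermitePoly]
  | succ m ih =>
    have e : C s * C s⁻¹ = (1 : ℝ[X]) := by rw [← C_mul, mul_inv_cancel₀ hs, C_1]
    rw [scaledHermitePoly, ih, hermite_succ, Polynomial.map_sub, Polynomial.map_mul, sub_comp,
      mul_comp, derivative_mul, derivative_C, derivative_comp, map_X, X_comp, derivative_map]
    simp only [derivative_mul, derivative_C, derivative_X, C_mul, C_pow, pow_succ, pow_zero, one_mul]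
    set p := ((hermite m).map (Int.castRingHom ℝ)).comp (C s⁻¹ * X)
    set q := (((derivative (hermite m))).map (Int.castRingHom ℝ)).comp (C s⁻¹ * X)
    linear_combination (-(C s ^ m * p * X) - C s ^ m * q * C s) * e

lemma scaledHermite_eq_eval {v : ℝ} (hv : 0 ≤ v) (m : ℕ) (x : ℝ) :
    scaledHermite m v x = (scaledHermitePoly v m).eval x := by
  unfold scaledHermite
  split_ifs with h
  · subst h
    have : scaledHermitePoly 0 m = X ^ m := by
      induction m with
      | zero => simp [scaledHermitePoly]
      | succ m ih => rw [scaledHermitePoly, ih, pow_succ]; simp [mul_comm]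
    simp [this]
  · have hs : √v ≠ 0 := (Real.sqrt_pos.2 (lt_of_le_of_ne hv (Ne.symm h))).ne'
    conv_rhs => rw [← Real.sq_sqrt hv]
    rw [comp_hermite_recursion hs, hermiteVal, aeval_def, ← eval_map]
    simp [div_eq_inv_mul]

/-- The operator `μ + v D` on polynomials. -/
def shiftOp (μ v : ℝ) : Module.End ℝ ℝ[X] :=
  algebraMap ℝ (Module.End ℝ ℝ[X]) μ + v • (derivative : ℝ[X] →ₗ[ℝ] ℝ[X])

/-- `E[P_m(U) f(U)] = E[((μ + v D)^m f)(U)]` -/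
lemma integral_scaledHermitePoly_mul (μ : ℝ) (v : ℝ≥0) (m : ℕ) (f : ℝ[X]) :
    ∫ x, (scaledHermitePoly v m * f).eval x ∂gaussianReal μ v =
      ∫ x, ((shiftOp μ v ^ m) f).eval x
        ∂gaussianReal μ v := by
  induction m generalizing f with
  | zero => simp [scaledHermitePoly]
  | succ m ih =>
    rw [pow_succ, Module.End.mul_apply, ← ih, scaledHermitePoly]
    -- Stein's identity gives E[(U - μ) P_m f] = v E[P_m' f + P_m f']. The term with P_m' is the one
    -- subtracted in P_{m+1}, which leaves E[P_m (μ f + v f')].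
    have hS := integral_sub_mul_eval_gaussianReal μ v (scaledHermitePoly v m * f)
    rw [← integral_const_mul] at hS
    have hi := fun p => integrable_eval_gaussianReal μ v p
    rw [← sub_eq_zero, ← integral_sub (hi _) (hi _)]
    rw [← sub_eq_zero, ← integral_sub ((hi ((X - C μ) * (scaledHermitePoly v m * f))).congr
        (ae_of_all _ fun x => by simp))
      ((hi (C (v : ℝ) * derivative (scaledHermitePoly v m * f))).congr
        (ae_of_all _ fun x => by simp))] at hS
    rw [← hS]
    congr 1; ext x
    simp [shiftOp, Algebra.algebraMap_eq_smul_one]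
    ring

lemma integral_scaledHermitePoly (μ : ℝ) (v : ℝ≥0) (m : ℕ) :
    ∫ x, (scaledHermitePoly v m).eval x ∂gaussianReal μ v = μ ^ m := by
  have h := integral_scaledHermitePoly_mul μ v m 1
  have e : ∀ m : ℕ, (shiftOp μ v ^ m) 1 =
      C (μ ^ m) := by
    intro m
    induction m with
    | zero => simp
    | succ m ih =>
      rw [pow_succ', Module.End.mul_apply, ih]
      simp [shiftOp, Algebra.algebraMap_eq_smul_one, smul_eq_C_mul, pow_succ']
  rw [mul_one, e] at h
  simpa using h

/-- Take f = P_m in the operator identity. Scalars commute with D, so (μ + vD)^m expands binomially;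
each D^{m-j} P_m is a multiple of P_j, whose mean is μ^j. -/
lemma integral_scaledHermitePoly_sq (μ : ℝ) (v : ℝ≥0) (m : ℕ) :
    ∫ x, (scaledHermitePoly v m).eval x ^ 2 ∂gaussianReal μ v =
      ∑ j ∈ Finset.range (m + 1), μ ^ j * (v : ℝ) ^ (m - j) * m.choose j *
        (m.descFactorial (m - j) * μ ^ j) := by
  have h := integral_scaledHermitePoly_mul μ v m (scaledHermitePoly v m)
  have hc : Commute (algebraMap ℝ (Module.End ℝ ℝ[X]) μ)
      ((v : ℝ) • (derivative : ℝ[X] →ₗ[ℝ] ℝ[X])) :=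
    Algebra.commutes μ _
  rw [shiftOp, hc.add_pow] at h
  simp only [← sq, eval_pow] at h
  rw [h]
  have e : ∀ x : ℝ, ((∑ j ∈ Finset.range (m + 1), algebraMap ℝ (Module.End ℝ ℝ[X]) μ ^ j *
      ((v : ℝ) • (derivative : ℝ[X] →ₗ[ℝ] ℝ[X])) ^ (m - j) * (m.choose j : Module.End ℝ ℝ[X]))
        (scaledHermitePoly v m)).eval x =
      ∑ j ∈ Finset.range (m + 1), μ ^ j * (v : ℝ) ^ (m - j) * m.choose j *
        (m.descFactorial (m - j) * (scaledHermitePoly v j).eval x) := by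
    intro x
    rw [LinearMap.sum_apply, eval_finsetSum]
    refine Finset.sum_congr rfl fun j hj => ?_
    have hj' : j ≤ m := by simpa [Nat.lt_succ_iff] using hj
    have h1 := iterate_derivative_scaledHermitePoly v m (m - j) (by omega)
    rw [Nat.sub_sub_self hj'] at h1
    have h2 : ((m.choose j : Module.End ℝ ℝ[X])) (scaledHermitePoly v m) =
        (m.choose j : ℝ) • scaledHermitePoly v m := by
      rw [Module.End.natCast_apply, Nat.cast_smul_eq_nsmul]
    rw [Module.End.mul_apply, h2, map_smul, Module.End.mul_apply, _root_.smul_pow, ← map_pow,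
      LinearMap.smul_apply, Module.End.pow_apply, h1, Module.algebraMap_end_apply]
    simp
    ring
  simp_rw [e]
  rw [integral_finsetSum]
  · refine Finset.sum_congr rfl fun j _ => ?_
    rw [integral_const_mul, integral_const_mul, integral_scaledHermitePoly]
  · intro j _
    exact ((integrable_eval_gaussianReal μ v _).const_mul _).const_mul _

/-- One term of the binomial expansion of ((1 - v) + v)^m = 1 is at most 1. -/
lemma choose_mul_pow_le {v : ℝ} (hv : 0 ≤ v) (hv1 : v < 1) {m j : ℕ} (hj : j ≤ m) :
    (m.choose j : ℝ) * v ^ (m - j) ≤ ((1 - v)⁻¹) ^ j := by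
  have h1 : 0 < 1 - v := by linarith
  have h := Finset.single_le_sum (f := fun j => (1 - v) ^ j * v ^ (m - j) * (m.choose j : ℝ))
    (s := Finset.range (m + 1)) (fun i _ => by positivity) (Finset.mem_range.2 (Nat.lt_succ_of_le hj))
  rw [← add_pow] at h
  simp only [sub_add_cancel, one_pow] at h
  rw [inv_pow, ← one_div, le_div_iff₀ (by positivity)]
  linarith

/-- Bounding the binomial weights by (1 - v)^{-j} turns the exact second moment into m! times a
partial sum of the series of exp(μ²/(1 - v)). -/
theorem integral_scaledHermitePoly_sq_le (μ : ℝ) (v : ℝ≥0) (hv : (v : ℝ) < 1) (m : ℕ) :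
    ∫ x, (scaledHermitePoly v m).eval x ^ 2 ∂gaussianReal μ v ≤
      m.factorial * Real.exp (μ ^ 2 / (1 - v)) := by
  have h1 : 0 < 1 - (v : ℝ) := by linarith
  rw [integral_scaledHermitePoly_sq]
  calc _ ≤ ∑ j ∈ Finset.range (m + 1), (m.factorial : ℝ) *
        ((μ ^ 2 / (1 - v)) ^ j / j.factorial) := by
        refine Finset.sum_le_sum fun j hj => ?_
        have hj' : j ≤ m := by simpa [Nat.lt_succ_iff] using hj
        have hd : (m.descFactorial (m - j) : ℝ) = m.factorial / j.factorial := by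
          rw [eq_div_iff (by positivity)]
          have := Nat.factorial_mul_descFactorial (Nat.sub_le m j)
          rw [Nat.sub_sub_self hj'] at this
          rw [← this]; push_cast; ring
        rw [hd]
        calc _ = (m.choose j * (v : ℝ) ^ (m - j)) * (m.factorial / j.factorial * (μ ^ 2) ^ j) := by
              ring
          _ ≤ ((1 - (v : ℝ))⁻¹) ^ j * (m.factorial / j.factorial * (μ ^ 2) ^ j) := by
              gcongr
              exact choose_mul_pow_le v.2 hv hj'
          _ = _ := by rw [div_eq_mul_inv (μ ^ 2), mul_pow]; ring
    _ ≤ _ := by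
        rw [← Finset.mul_sum]
        gcongr
        exact Real.sum_le_exp_of_nonneg (by positivity) _

end HermitePolynomials

/-! ### The function G and its Taylor expansion at 0. -/

lemma stdPDF_eq (w : ℝ) : stdPDF w = stdPDF 0 * Real.exp (-(w ^ 2 / 2)) := by
  simp [stdPDF, gaussianPDFReal, neg_div]

lemma stdPDF_nonneg (w : ℝ) : 0 ≤ stdPDF w := gaussianPDFReal_nonneg 0 1 w

lemma stdPDF_zero_le_one : stdPDF 0 ≤ 1 := by
  simp only [stdPDF, gaussianPDFReal]
  have h : (1 : ℝ) ≤ √(2 * Real.pi * (1 : ℝ≥0)) := by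
    rw [Real.one_le_sqrt]
    have := Real.pi_gt_three
    simp; linarith
  simpa using inv_le_one_of_one_le₀ h

lemma stdPDF_le_one (w : ℝ) : stdPDF w ≤ 1 := by
  rw [stdPDF_eq]
  have h := stdPDF_nonneg 0
  have h2 : Real.exp (-(w ^ 2 / 2)) ≤ 1 := by
    rw [Real.exp_le_one_iff]
    have := sq_nonneg w
    linarith
  have := Real.exp_pos (-(w ^ 2 / 2))
  nlinarith [stdPDF_zero_le_one]

lemma hasDerivAt_stdPDF (w : ℝ) : HasDerivAt stdPDF (-(w * stdPDF w)) w := by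
  have := hasDerivAt_gaussianPDFReal 0 1 one_ne_zero w
  refine this.congr_deriv ?_
  simp [stdPDF]

lemma hasDerivAt_stdCDF (w : ℝ) : HasDerivAt stdCDF (stdPDF w) w := by
  have hint : Integrable stdPDF := integrable_gaussianPDFReal 0 1
  have hc : Continuous stdPDF :=
    continuous_iff_continuousAt.2 fun x => (hasDerivAt_stdPDF x).continuousAt
  have e : ∀ x, stdCDF x = ∫ t in Set.Iic x, stdPDF t := by
    intro x
    rw [stdCDF, cdf_eq_real, measureReal_def, gaussianReal_apply_eq_integral 0 one_ne_zero,
      ENNReal.toReal_ofReal]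
    · rfl
    · exact integral_nonneg fun _ => gaussianPDFReal_nonneg 0 1 _
  have e2 : stdCDF = fun x => stdCDF 0 + ∫ t in (0 : ℝ)..x, stdPDF t := by
    ext x
    rw [e x, e 0, ← intervalIntegral.integral_Iic_sub_Iic hint.integrableOn hint.integrableOn]
    ring
  rw [e2]
  exact (intervalIntegral.integral_hasDerivAt_right hint.intervalIntegrable
    (hc.stronglyMeasurableAtFilter _ _) hc.continuousAt).const_add _

lemma hasDerivAt_G (β w : ℝ) : HasDerivAt (fun w => G w β) (stdCDF w - β) w := by
  have h := ((hasDerivAt_stdPDF w).add ((hasDerivAt_id w).mul (hasDerivAt_stdCDF w))).sub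
    ((hasDerivAt_id w).const_mul β)
  refine h.congr_deriv ?_
  simp

lemma stdCDF_nonneg (w : ℝ) : 0 ≤ stdCDF w := cdf_nonneg _ w

lemma stdCDF_le_one (w : ℝ) : stdCDF w ≤ 1 := cdf_le_one _ w

lemma hermiteVal_zero_right (k : ℕ) :
    hermiteVal k 0 = if Even k then (-1 : ℝ) ^ (k / 2) * ((k - 1).doubleFactorial : ℝ) else 0 := by
  rw [hermiteVal, ← Polynomial.coeff_zero_eq_aeval_zero', Polynomial.coeff_hermite]
  split_ifs <;> simp_all

lemma doubleFactorial_le_succ (k : ℕ) : k.doubleFactorial ≤ (k + 1).doubleFactorial := by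
  induction k using Nat.strong_induction_on with
  | _ k ih =>
    match k with
    | 0 => simp
    | 1 => simp [Nat.doubleFactorial]
    | k + 2 =>
      rw [Nat.doubleFactorial_add_two, Nat.doubleFactorial_add_two]
      exact Nat.mul_le_mul (by omega) (ih k (by omega))

/-- For even k > 0, (k-1)!!² ≤ (k-1)!! k!! = k!. -/
lemma hermiteVal_zero_sq_le (k : ℕ) : hermiteVal k 0 ^ 2 ≤ k.factorial := by
  rw [hermiteVal_zero_right]
  split_ifs
  · rw [mul_pow, ← pow_mul, mul_comm (k / 2), pow_mul, neg_one_sq, one_pow, one_mul]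
    rcases k with _ | k
    · simp
    · rw [Nat.add_sub_cancel, Nat.factorial_eq_mul_doubleFactorial, sq]
      exact_mod_cast Nat.mul_le_mul_right _ (doubleFactorial_le_succ k)
  · simp

lemma hermiteVal_two_mul_div_factorial (j : ℕ) :
    hermiteVal (2 * j) 0 / ((2 * j).factorial : ℝ) = (-1 / 2) ^ j / j.factorial := by
  rw [hermiteVal_zero_right, if_pos (even_two_mul j), Nat.mul_div_cancel_left _ two_pos]
  rcases j with _ | j
  · simp
  · have e : 2 * (j + 1) = (2 * j + 1) + 1 := by ring
    have h0 : ((2 * j + 1).doubleFactorial : ℝ) ≠ 0 := by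
      exact_mod_cast (Nat.doubleFactorial_pos _).ne'
    rw [e, Nat.add_sub_cancel, Nat.factorial_eq_mul_doubleFactorial, ← e,
      Nat.doubleFactorial_two_mul, div_pow]
    push_cast
    field_simp

/-- The sum is the Taylor polynomial of φ(w)/φ(0) = exp(-w²/2); its odd coefficients vanish, hence
the halved range. -/
lemma sum_hermiteVal_zero (M : ℕ) (w : ℝ) :
    ∑ k ∈ Finset.range M, (-1) ^ k * hermiteVal k 0 / (k.factorial : ℝ) * w ^ k =
      ∑ j ∈ Finset.range ((M + 1) / 2), (-(w ^ 2 / 2)) ^ j / j.factorial := by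
  induction M with
  | zero => simp
  | succ M ih =>
    rw [Finset.sum_range_succ, ih]
    rcases Nat.even_or_odd' M with ⟨j, rfl | rfl⟩
    · have e1 : (2 * j + 1) / 2 = j := by omega
      have e2 : (2 * j + 1 + 1) / 2 = j + 1 := by omega
      rw [e1, e2, Finset.sum_range_succ, mul_div_assoc, hermiteVal_two_mul_div_factorial]
      congr 1
      rw [show -(w ^ 2 / 2) = -1 / 2 * w ^ 2 by ring, mul_pow, pow_mul, pow_mul w, neg_one_sq,
        one_pow]
      ring
    · have e1 : (2 * j + 1 + 1) / 2 = j + 1 := by omega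
      have e2 : (2 * j + 1 + 1 + 1) / 2 = j + 1 := by omega
      rw [e1, e2, hermiteVal_zero_right, if_neg (by simp)]
      simp

/-- Remainder of the exponential series. -/
lemma abs_exp_sub_sum_le (z : ℝ) (N : ℕ) (hN : Real.exp 1 ^ 2 * |z| ≤ N) :
    |Real.exp z - ∑ j ∈ Finset.range N, z ^ j / j.factorial| ≤ Real.exp (-(N / 2 : ℝ)) := by
  have hs : ∀ x : ℝ, HasSum (fun j : ℕ => x ^ j / j.factorial) (Real.exp x) := fun x => by
    rw [Real.exp_eq_exp_ℝ]
    exact NormedSpace.expSeries_div_hasSum_exp x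
  set c := Real.exp 1 with hc
  have hc1 : 1 ≤ c := by rw [hc]; exact Real.one_le_exp zero_le_one
  have hc0 : 0 < c := by linarith
  have h1 := (hasSum_nat_add_iff' N).2 (hs z)
  have h2 := (hasSum_nat_add_iff' N).2 (hs (c * |z|))
  have h3 := h2.mul_left (c ^ N)⁻¹
  rw [← Real.norm_eq_abs]
  -- For exponents j ≥ N, |z|^j ≤ c^{-N} (c|z|)^j with c = e. The tail is then at most e^{-N}
  -- e^{e|z|}, and the hypothesis gives e|z| ≤ N/2.
  have hb : ‖Real.exp z - ∑ j ∈ Finset.range N, z ^ j / j.factorial‖ ≤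
      (c ^ N)⁻¹ * (Real.exp (c * |z|) - ∑ j ∈ Finset.range N, (c * |z|) ^ j / j.factorial) := by
    refine HasSum.norm_le_of_bounded h1 h3 fun j => ?_
    rw [norm_div, norm_pow, Real.norm_eq_abs, Real.norm_natCast, mul_pow, pow_add c]
    have : (1 : ℝ) ≤ c ^ j := one_le_pow₀ hc1
    rw [show (c ^ N)⁻¹ * (c ^ j * c ^ N * |z| ^ (j + N) / (j + N).factorial) =
      c ^ j * (|z| ^ (j + N) / (j + N).factorial) by field_simp]
    exact le_mul_of_one_le_left (by positivity) this
  refine hb.trans ?_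
  have hsum : 0 ≤ ∑ j ∈ Finset.range N, (c * |z|) ^ j / j.factorial :=
    Finset.sum_nonneg fun j _ => by positivity
  have hcN : (c ^ N)⁻¹ = Real.exp (-N) := by
    rw [hc, ← Real.exp_nat_mul, ← Real.exp_neg]; simp
  have hz : c * |z| ≤ N / 2 := by
    have h2 : 2 ≤ c := by have := Real.exp_one_gt_d9; rw [hc]; linarith
    have : 0 ≤ c * |z| := by positivity
    nlinarith
  calc _ ≤ (c ^ N)⁻¹ * Real.exp (c * |z|) := by gcongr; linarith
    _ = Real.exp (-N + c * |z|) := by rw [hcN, Real.exp_add]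
    _ ≤ _ := by gcongr; linarith

/-- Taylor coefficients of `G` at `0`. -/
def taylorCoef (β : ℝ) : ℕ → ℝ
  | 0 => G 0 β
  | 1 => stdCDF 0 - β
  | k + 2 => stdPDF 0 * ((-1) ^ k * hermiteVal k 0 / ((k + 2).factorial : ℝ))

lemma sum_taylorCoef (β : ℝ) (M : ℕ) (f : ℕ → ℝ) :
    ∑ k ∈ Finset.range (M + 2), taylorCoef β k * f k = G 0 β * f 0 + (stdCDF 0 - β) * f 1 +
      stdPDF 0 * ∑ k ∈ Finset.range M,
        (-1) ^ k * hermiteVal k 0 / ((k + 2).factorial : ℝ) * f (k + 2) := by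
  rw [Finset.sum_range_succ', Finset.sum_range_succ', Finset.mul_sum]
  simp only [taylorCoef, zero_add, mul_assoc]
  ring

/-- The constant and linear terms are those of P_0 = 1 and P_1 = u, so S is a single sum over
degrees 0 to K_n. The natural subtraction is exact because K_n ≥ 1. -/
lemma seriesEst_eq_sum {σp : ℝ} (hσ : 0 < σp) (γ σf β : ℝ) (n : ℕ) (τ : ℝ≥0∞) (u : ℝ) :
    seriesEst γ σp σf β n τ u = ∑ k ∈ Finset.range (truncOrder γ σp σf n - 1 + 2),
      taylorCoef β k * (scaledHermitePoly (2 * σp * coefD σp σf τ ^ 2) k).eval u := by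
  have hv : 0 ≤ 2 * σp * coefD σp σf τ ^ 2 := by positivity
  rw [sum_taylorCoef, seriesEst, (hasDerivAt_G β 0).deriv]
  simp only [scaledHermite_eq_eval hv]
  simp [scaledHermitePoly]

/-- This decay of the coefficients cancels the k! in the second moment of P_k. -/
lemma taylorCoef_sq_mul_factorial_le {β : ℝ} (h0 : 0 ≤ β) (h1 : β ≤ 1) (k : ℕ) :
    taylorCoef β k ^ 2 * k.factorial ≤ 1 := by
  have hp := stdPDF_nonneg 0
  have hp1 := stdPDF_zero_le_one
  match k with
  | 0 =>
    simp only [taylorCoef, G]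
    simp only [zero_mul, mul_zero, add_zero, sub_zero, Nat.factorial_zero, Nat.cast_one, mul_one]
    nlinarith
  | 1 =>
    simp only [taylorCoef, Nat.factorial_one, Nat.cast_one, mul_one]
    have := stdCDF_nonneg 0
    have := stdCDF_le_one 0
    nlinarith
  | k + 2 =>
    have hk := hermiteVal_zero_sq_le k
    have hf : (k.factorial : ℝ) ≤ (k + 2).factorial := by
      exact_mod_cast Nat.factorial_le (by omega)
    have hpos : (0 : ℝ) < (k + 2).factorial := by positivity
    have e : taylorCoef β (k + 2) ^ 2 * (k + 2).factorial =
        stdPDF 0 ^ 2 * (hermiteVal k 0 ^ 2 / (k + 2).factorial) := by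
      simp only [taylorCoef, mul_pow, div_pow]
      rw [← pow_mul, mul_comm k, pow_mul, neg_one_sq, one_pow]
      field_simp
    rw [e]
    have h3 : hermiteVal k 0 ^ 2 / (k + 2).factorial ≤ 1 := by
      rw [div_le_one hpos]; linarith
    have h4 : stdPDF 0 ^ 2 ≤ 1 := by nlinarith
    exact mul_le_one₀ h4 (by positivity) h3

/-- Taylor's theorem for `G` with explicit remainder. -/
theorem abs_sum_taylorCoef_sub_G_le (β : ℝ) (M : ℕ) {μ W : ℝ} (hμ : |μ| ≤ W)
    (hM : Real.exp 1 ^ 2 * W ^ 2 ≤ M) :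
    |∑ k ∈ Finset.range (M + 2), taylorCoef β k * μ ^ k - G μ β| ≤
      W ^ 2 * Real.exp (-(M / 4 : ℝ)) := by
  set ε := Real.exp (-(M / 4 : ℝ)) with hε
  have hW : 0 ≤ W := (abs_nonneg μ).trans hμ
  set a : ℕ → ℝ := fun k => (-1) ^ k * hermiteVal k 0 / (k.factorial : ℝ) with ha
  -- R is the Taylor remainder of G, and R1, R2 are its first two derivatives. R2 is the remainder
  -- of φ, which the exponential series controls; since R and R1 vanish at 0, two mean value
  -- inequalities carry the bound back to R.
  set R : ℝ → ℝ := fun w => G 0 β + (stdCDF 0 - β) * w +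
    stdPDF 0 * ∑ k ∈ Finset.range M, a k * (w ^ (k + 2) / (((k : ℝ) + 2) * (k + 1))) - G w β with hR
  set R1 : ℝ → ℝ := fun w => (stdCDF 0 - β) +
    stdPDF 0 * ∑ k ∈ Finset.range M, a k * (w ^ (k + 1) / ((k : ℝ) + 1)) - (stdCDF w - β) with hR1
  set R2 : ℝ → ℝ := fun w => stdPDF 0 * ∑ k ∈ Finset.range M, a k * w ^ k - stdPDF w with hR2
  have d0 : ∀ w, HasDerivAt R (R1 w) w := by
    intro w
    refine HasDerivAt.sub (HasDerivAt.add ?_ (HasDerivAt.const_mul _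
      (HasDerivAt.fun_sum fun k _ => HasDerivAt.const_mul _ ?_))) (hasDerivAt_G β w)
    · simpa using ((hasDerivAt_id w).const_mul (stdCDF 0 - β)).const_add (G 0 β)
    · refine ((hasDerivAt_pow (k + 2) w).div_const _).congr_deriv ?_
      have : (k : ℝ) + 2 ≠ 0 := by positivity
      have : (k : ℝ) + 1 ≠ 0 := by positivity
      push_cast
      field_simp
  have d1 : ∀ w, HasDerivAt R1 (R2 w) w := by
    intro w
    refine HasDerivAt.sub (HasDerivAt.const_add _ (HasDerivAt.const_mul _
      (HasDerivAt.fun_sum fun k _ => HasDerivAt.const_mul _ ?_)))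
      ((hasDerivAt_stdCDF w).sub_const β)
    refine ((hasDerivAt_pow (k + 1) w).div_const _).congr_deriv ?_
    have : (k : ℝ) + 1 ≠ 0 := by positivity
    push_cast
    field_simp
  have b2 : ∀ w, |w| ≤ W → ‖R2 w‖ ≤ ε := by
    intro w hw
    simp only [hR2, ha]
    rw [sum_hermiteVal_zero, stdPDF_eq w, ← mul_sub, norm_mul, Real.norm_eq_abs,
      abs_of_nonneg (stdPDF_nonneg 0), norm_sub_rev, Real.norm_eq_abs]
    -- Only about half of the M terms are nonzero, so the exponent N/2 becomes M/4.
    have hN : (M : ℝ) / 2 ≤ ((M + 1) / 2 : ℕ) := by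
      have : M ≤ 2 * ((M + 1) / 2) := by omega
      have : (M : ℝ) ≤ 2 * ((M + 1) / 2 : ℕ) := by exact_mod_cast this
      linarith
    have hw2 : w ^ 2 ≤ W ^ 2 := sq_le_sq' (by linarith [neg_abs_le w]) ((le_abs_self w).trans hw)
    have hcond : Real.exp 1 ^ 2 * |-(w ^ 2 / 2)| ≤ ((M + 1) / 2 : ℕ) := by
      rw [abs_neg, abs_of_nonneg (by positivity)]
      have : Real.exp 1 ^ 2 * w ^ 2 ≤ Real.exp 1 ^ 2 * W ^ 2 := by gcongr
      linarith
    have hb := abs_exp_sub_sum_le _ _ hcond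
    refine (mul_le_of_le_one_left (abs_nonneg _) stdPDF_zero_le_one).trans (hb.trans ?_)
    exact Real.exp_le_exp.2 (by linarith)
  have hmem : ∀ w, w ∈ Set.Icc (-W) W ↔ |w| ≤ W := fun w => by rw [abs_le, Set.mem_Icc]
  have h0mem : (0 : ℝ) ∈ Set.Icc (-W) W := by rw [hmem]; simpa
  have z1 : R1 0 = 0 := by simp [hR1]
  have z0 : R 0 = 0 := by simp [hR]
  have hε0 : 0 ≤ ε := (Real.exp_pos _).le
  have b1 : ∀ w ∈ Set.Icc (-W) W, ‖R1 w‖ ≤ ε * W := by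
    intro w hw
    have := (convex_Icc (-W) W).norm_image_sub_le_of_norm_hasDerivWithin_le
      (fun x _ => (d1 x).hasDerivWithinAt) (fun x hx => b2 x ((hmem x).1 hx)) h0mem hw
    rw [z1, sub_zero, sub_zero, Real.norm_eq_abs w] at this
    exact this.trans (by gcongr; exact (hmem w).1 hw)
  have b0 := (convex_Icc (-W) W).norm_image_sub_le_of_norm_hasDerivWithin_le
      (fun x _ => (d0 x).hasDerivWithinAt) b1 h0mem ((hmem μ).2 hμ)
  rw [z0, sub_zero, sub_zero, Real.norm_eq_abs, Real.norm_eq_abs] at b0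
  have e : ∑ k ∈ Finset.range (M + 2), taylorCoef β k * μ ^ k - G μ β = R μ := by
    rw [sum_taylorCoef]
    simp only [hR, ha, pow_zero, mul_one, pow_one]
    congr 3
    refine Finset.sum_congr rfl fun k _ => ?_
    rw [Nat.factorial_succ, Nat.factorial_succ]
    push_cast
    have : (k : ℝ) + 2 ≠ 0 := by positivity
    have : (k : ℝ) + 1 ≠ 0 := by positivity
    have : (k : ℝ) + 1 + 1 ≠ 0 := by positivity
    have : (k.factorial : ℝ) ≠ 0 := by positivity
    field_simp
    ring
  rw [e]
  calc |R μ| ≤ ε * W * |μ| := b0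
    _ ≤ ε * W * W := by gcongr
    _ = _ := by ring

/-! ### Moments of Hermite sums. -/

/-- A finite combination of the polynomials `P_k`. -/
def hermiteSum (e : ℕ → ℝ) (v : ℝ) (N : ℕ) (u : ℝ) : ℝ :=
  ∑ k ∈ Finset.range N, e k * (scaledHermitePoly v k).eval u

lemma measurable_hermiteSum (e : ℕ → ℝ) (v : ℝ) (N : ℕ) : Measurable (hermiteSum e v N) := by
  unfold hermiteSum
  fun_prop

lemma integrable_scaledHermitePoly (μ : ℝ) (v : ℝ≥0) (k : ℕ) :
    Integrable (fun x => (scaledHermitePoly v k).eval x) (gaussianReal μ v) :=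
  integrable_eval_gaussianReal μ v _

lemma integrable_hermiteSum (e : ℕ → ℝ) (μ : ℝ) (v : ℝ≥0) (N : ℕ) :
    Integrable (hermiteSum e v N) (gaussianReal μ v) :=
  integrable_finsetSum _ fun k _ => (integrable_scaledHermitePoly μ v k).const_mul _

lemma integrable_hermiteSum_sq (e : ℕ → ℝ) (μ : ℝ) (v : ℝ≥0) (N : ℕ) :
    Integrable (fun u => hermiteSum e v N u ^ 2) (gaussianReal μ v) := by
  refine (integrable_eval_gaussianReal μ v
    ((∑ k ∈ Finset.range N, Polynomial.C (e k) * scaledHermitePoly v k) ^ 2)).congr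
      (ae_of_all _ fun u => ?_)
  simp [hermiteSum, Polynomial.eval_finsetSum]

lemma integral_hermiteSum (e : ℕ → ℝ) (μ : ℝ) (v : ℝ≥0) (N : ℕ) :
    ∫ u, hermiteSum e v N u ∂gaussianReal μ v = ∑ k ∈ Finset.range N, e k * μ ^ k := by
  unfold hermiteSum
  rw [integral_finsetSum _ fun k _ => (integrable_scaledHermitePoly μ v k).const_mul _]
  simp_rw [integral_const_mul, integral_scaledHermitePoly]

/-- Cauchy–Schwarz over the N terms, each of mean square at most exp(μ²/(1 - v)). -/
theorem integral_hermiteSum_sq_le {e : ℕ → ℝ} (he : ∀ k, e k ^ 2 * k.factorial ≤ 1) (μ : ℝ)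
    (v : ℝ≥0) (hv : (v : ℝ) < 1) (N : ℕ) :
    ∫ u, hermiteSum e v N u ^ 2 ∂gaussianReal μ v ≤ (N : ℝ) ^ 2 * Real.exp (μ ^ 2 / (1 - v)) := by
  have hi : ∀ k, Integrable (fun u => (scaledHermitePoly v k).eval u ^ 2) (gaussianReal μ v) :=
    fun k => (integrable_eval_gaussianReal μ v (scaledHermitePoly v k ^ 2)).congr
      (ae_of_all _ fun u => by simp)
  calc _ ≤ ∫ u, (N : ℝ) * ∑ k ∈ Finset.range N, e k ^ 2 * (scaledHermitePoly v k).eval u ^ 2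
          ∂gaussianReal μ v := by
        refine integral_mono (integrable_hermiteSum_sq e μ v N)
          ((integrable_finsetSum _ fun k _ => (hi k).const_mul _).const_mul _) fun u => ?_
        have := sq_sum_le_card_mul_sum_sq (s := Finset.range N)
          (f := fun k => e k * (scaledHermitePoly v k).eval u)
        simpa [hermiteSum, mul_pow] using this
    _ = (N : ℝ) * ∑ k ∈ Finset.range N,
          e k ^ 2 * ∫ u, (scaledHermitePoly v k).eval u ^ 2 ∂gaussianReal μ v := by
        rw [integral_const_mul, integral_finsetSum _ fun k _ => (hi k).const_mul _]
        simp_rw [integral_const_mul]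
    _ ≤ (N : ℝ) * ∑ k ∈ Finset.range N, Real.exp (μ ^ 2 / (1 - v)) := by
        gcongr with k hk
        calc _ ≤ e k ^ 2 * (k.factorial * Real.exp (μ ^ 2 / (1 - v))) := by
              gcongr
              exact integral_scaledHermitePoly_sq_le μ v hv k
          _ = (e k ^ 2 * k.factorial) * Real.exp (μ ^ 2 / (1 - v)) := by ring
          _ ≤ _ := mul_le_of_le_one_left (Real.exp_pos _).le (he k)
    _ = _ := by simp; ring

/-! ### Second moments and tail bounds for normal laws. -/

lemma integrable_id_gaussianReal (μ : ℝ) (v : ℝ≥0) :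
    Integrable (fun x => x) (gaussianReal μ v) := by
  simpa using integrable_eval_gaussianReal μ v Polynomial.X

lemma integrable_affine_sq (μ : ℝ) (v : ℝ≥0) (a b : ℝ) :
    Integrable (fun x => (a * x + b) ^ 2) (gaussianReal μ v) := by
  exact (integrable_eval_gaussianReal μ v
    ((Polynomial.C a * Polynomial.X + Polynomial.C b) ^ 2)).congr (ae_of_all _ fun x => by simp)

lemma integral_affine_sq (μ : ℝ) (v : ℝ≥0) (a b : ℝ) :
    ∫ x, (a * x + b) ^ 2 ∂gaussianReal μ v = a ^ 2 * v + (a * μ + b) ^ 2 := by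
  have h := integral_sub_mul_eval_gaussianReal μ v Polynomial.X
  simp only [Polynomial.eval_X, Polynomial.derivative_X, Polynomial.eval_one, integral_const,
    probReal_univ, one_smul, mul_one] at h
  have hi : Integrable (fun x => (x - μ) * x) (gaussianReal μ v) := by
    exact (integrable_eval_gaussianReal μ v ((Polynomial.X - Polynomial.C μ) *
      Polynomial.X)).congr (ae_of_all _ fun x => by simp)
  have e : (fun x : ℝ => (a * x + b) ^ 2) = fun x =>
      a ^ 2 * ((x - μ) * x) + ((a ^ 2 * μ + 2 * a * b) * x + b ^ 2) := by ext x; ring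
  rw [e, integral_add (hi.const_mul _) (((integrable_id_gaussianReal μ v).const_mul _).fun_add
    (integrable_const _)), integral_add ((integrable_id_gaussianReal μ v).const_mul _)
    (integrable_const _), integral_const_mul, integral_const_mul, h, integral_id_gaussianReal]
  simp
  ring

/-- Chebyshev's inequality for a set at distance at least `t` from the mean. -/
lemma gaussianReal_mul_sq_le (μ : ℝ) (v : ℝ≥0) {s : Set ℝ} {t : ℝ} (ht : 0 ≤ t)
    (hs : ∀ x ∈ s, t ≤ |x - μ|) : (gaussianReal μ v).real s * t ^ 2 ≤ v := by
  have h := mul_meas_ge_le_integral_of_nonneg (μ := gaussianReal μ v)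
    (f := fun x => (1 * x + (-μ)) ^ 2) (ae_of_all _ fun x => by positivity)
    (integrable_affine_sq μ v _ _) (t ^ 2)
  rw [integral_affine_sq] at h
  have hsub : (gaussianReal μ v).real s ≤ (gaussianReal μ v).real
      {x | t ^ 2 ≤ (1 * x + (-μ)) ^ 2} := by
    refine measureReal_mono fun x hx => ?_
    have := hs x hx
    simp only [one_mul, ← sub_eq_add_neg, Set.mem_ofPred_eq]
    rw [← sq_abs (x - μ)]
    gcongr
  have : (gaussianReal μ v).real s * t ^ 2 ≤
      (gaussianReal μ v).real {x | t ^ 2 ≤ (1 * x + (-μ)) ^ 2} * t ^ 2 := by gcongr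
  linarith

/-- Chernoff's bound at exponent t/w. Using w > 0 in place of v covers the degenerate law v = 0,
which occurs at τ = ∞. -/
lemma gaussianReal_real_ge_le (μ : ℝ) (v : ℝ≥0) {w t : ℝ} (hw : 0 < w) (hv : (v : ℝ) ≤ w)
    (ht : 0 ≤ t) : (gaussianReal μ v).real {x | μ + t ≤ x} ≤ Real.exp (-(t ^ 2 / (2 * w))) := by
  have h := measure_ge_le_exp_mul_mgf (μ := gaussianReal μ v) (X := fun x => x) (t := t / w)
    (μ + t) (by positivity) (integrable_exp_mul_gaussianReal _)
  rw [mgf_fun_id_gaussianReal, ← Real.exp_add] at h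
  refine h.trans (Real.exp_le_exp.2 ?_)
  have h1 : (v : ℝ) * (t / w) ^ 2 / 2 ≤ w * (t / w) ^ 2 / 2 := by gcongr
  have h2 : -(t / w) * (μ + t) + (μ * (t / w) + w * (t / w) ^ 2 / 2) = -(t ^ 2 / (2 * w)) := by
    field_simp; ring
  linarith

lemma gaussianReal_real_le_le (μ : ℝ) (v : ℝ≥0) {w t : ℝ} (hw : 0 < w) (hv : (v : ℝ) ≤ w)
    (ht : 0 ≤ t) : (gaussianReal μ v).real {x | x ≤ μ - t} ≤ Real.exp (-(t ^ 2 / (2 * w))) := by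
  have h := measure_le_le_exp_mul_mgf (μ := gaussianReal μ v) (X := fun x => x) (t := -(t / w))
    (μ - t) (by rw [neg_nonpos]; positivity) (integrable_exp_mul_gaussianReal _)
  rw [mgf_fun_id_gaussianReal, ← Real.exp_add] at h
  refine h.trans (Real.exp_le_exp.2 ?_)
  have h1 : (v : ℝ) * (t / w) ^ 2 / 2 ≤ w * (t / w) ^ 2 / 2 := by gcongr
  have h2 : - -(t / w) * (μ - t) + (μ * -(t / w) + w * (-(t / w)) ^ 2 / 2) =
      -(t ^ 2 / (2 * w)) := by
    field_simp; ring
  rw [neg_sq] at *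
  linarith

/-- The mass of `[-lam, lam]` when the mean is at distance at least `t` from it. -/
lemma gaussianReal_Icc_le (μ : ℝ) (v : ℝ≥0) {w t lam : ℝ} (hw : 0 < w) (hv : (v : ℝ) ≤ w)
    (ht : 0 ≤ t) (hμ : t ≤ |μ| - lam) :
    (gaussianReal μ v).real (Set.Icc (-lam) lam) ≤ Real.exp (-(t ^ 2 / (2 * w))) := by
  rcases le_total 0 μ with h | h
  · rw [abs_of_nonneg h] at hμ
    refine (measureReal_mono fun x hx => ?_).trans (gaussianReal_real_le_le μ v hw hv ht)
    simp only [Set.mem_ofPred_eq]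
    linarith [hx.2]
  · rw [abs_of_nonpos h] at hμ
    refine (measureReal_mono fun x hx => ?_).trans (gaussianReal_real_ge_le μ v hw hv ht)
    simp only [Set.mem_ofPred_eq]
    linarith [hx.1]

/-- For |μ| > λ the normal tail decays at rate 1/(2w) ≥ 5/2 in (|μ| - λ)², while the exponential
grows at rate at most 5/4 in μ², so the decay wins. -/
lemma gaussianReal_Icc_mul_exp_le (μ : ℝ) (v : ℝ≥0) {w lam : ℝ} (hw : 0 < w) (hw5 : w ≤ 1 / 5)
    (hv : (v : ℝ) ≤ w) (_hlam : 0 ≤ lam) :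
    (gaussianReal μ v).real (Set.Icc (-lam) lam) * Real.exp (μ ^ 2 / (1 - v)) ≤
      Real.exp (5 / 2 * lam ^ 2) := by
  have hμ : μ ^ 2 / (1 - (v : ℝ)) ≤ 5 / 4 * |μ| ^ 2 := by
    rw [sq_abs, div_le_iff₀ (by linarith)]
    nlinarith [sq_nonneg μ]
  rcases le_total |μ| lam with h | h
  · have h1 : (gaussianReal μ v).real (Set.Icc (-lam) lam) ≤ 1 := measureReal_le_one
    refine (mul_le_of_le_one_left (Real.exp_pos _).le h1).trans (Real.exp_le_exp.2 ?_)
    have : |μ| ^ 2 ≤ lam ^ 2 := by gcongr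
    nlinarith
  · have h1 := gaussianReal_Icc_le μ v hw hv (sub_nonneg.2 h) le_rfl
    calc _ ≤ Real.exp (-((|μ| - lam) ^ 2 / (2 * w))) * Real.exp (μ ^ 2 / (1 - v)) := by gcongr
      _ = Real.exp (-((|μ| - lam) ^ 2 / (2 * w)) + μ ^ 2 / (1 - v)) := by rw [Real.exp_add]
      _ ≤ _ := by
        refine Real.exp_le_exp.2 ?_
        have h2 : 5 / 2 * (|μ| - lam) ^ 2 ≤ (|μ| - lam) ^ 2 / (2 * w) := by
          rw [le_div_iff₀ (by linarith)]
          nlinarith [sq_nonneg (|μ| - lam)]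
        -- The difference of the two sides is the square (5/4)(|μ| - 2λ)².
        nlinarith [sq_nonneg (|μ| - 2 * lam)]

/-! ### Switching on an independent coordinate, truncation, and the outer ranges. -/

/-- Integration of a function that switches according to an independent second coordinate. -/
lemma integral_threshold (ν : Measure ℝ) [IsProbabilityMeasure ν] {lam : ℝ} (hlam : 0 ≤ lam)
    {f g h : ℝ → ℝ} (hf : Integrable f ν) (hg : Integrable g ν) (hh : Integrable h ν) :
    ∫ p, (if p.2 < -lam then f p.1 else if p.2 ≤ lam then g p.1 else h p.1) ∂ν.prod ν =
      ν.real (Set.Iio (-lam)) * ∫ x, f x ∂ν + ν.real (Set.Icc (-lam) lam) * ∫ x, g x ∂ν +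
        ν.real (Set.Ioi lam) * ∫ x, h x ∂ν := by
  have hi : ∀ s : Set ℝ, MeasurableSet s → Integrable (s.indicator (1 : ℝ → ℝ)) ν := fun s hs =>
    (integrable_const (1 : ℝ)).indicator hs
  have e : ∀ p : ℝ × ℝ, (if p.2 < -lam then f p.1 else if p.2 ≤ lam then g p.1 else h p.1) =
      f p.1 * (Set.Iio (-lam)).indicator 1 p.2 + g p.1 * (Set.Icc (-lam) lam).indicator 1 p.2 +
        h p.1 * (Set.Ioi lam).indicator 1 p.2 := by
    intro p
    simp only [Set.indicator_apply, Set.mem_Iio, Set.mem_Icc, Set.mem_Ioi, Pi.one_apply]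
    split_ifs <;> first | (exfalso; linarith) | (exfalso; grind) | simp
  simp_rw [e]
  rw [integral_add, integral_add, integral_prod_mul, integral_prod_mul, integral_prod_mul,
    integral_indicator_one measurableSet_Iio, integral_indicator_one measurableSet_Icc,
    integral_indicator_one measurableSet_Ioi]
  · ring
  · exact hf.mul_prod (hi _ measurableSet_Iio)
  · exact hg.mul_prod (hi _ measurableSet_Icc)
  · exact (hf.mul_prod (hi _ measurableSet_Iio)).add (hg.mul_prod (hi _ measurableSet_Icc))
  · exact hh.mul_prod (hi _ measurableSet_Ioi)

lemma real_Iio_add_Icc_add_Ioi (ν : Measure ℝ) [IsProbabilityMeasure ν] {lam : ℝ}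
    (hlam : 0 ≤ lam) :
    ν.real (Set.Iio (-lam)) + ν.real (Set.Icc (-lam) lam) + ν.real (Set.Ioi lam) = 1 := by
  have := integral_threshold ν hlam (integrable_const (1 : ℝ)) (integrable_const (1 : ℝ))
    (integrable_const (1 : ℝ))
  simpa using this.symm

/-- Truncation of `s` at absolute value `n`. -/
def clip (n s : ℝ) : ℝ := Real.sign s * min |s| n

lemma abs_sign_le_one (s : ℝ) : |Real.sign s| ≤ 1 := by
  rcases Real.sign_apply_eq s with h | h | h <;> simp [h]

lemma abs_clip_le_abs {n : ℝ} (hn : 0 ≤ n) (s : ℝ) : |clip n s| ≤ |s| := by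
  have h0 : 0 ≤ min |s| n := le_min (abs_nonneg s) hn
  rw [clip, abs_mul, abs_of_nonneg h0]
  exact (mul_le_of_le_one_left h0 (abs_sign_le_one s)).trans (min_le_left _ _)

lemma abs_clip_le {n : ℝ} (hn : 0 ≤ n) (s : ℝ) : |clip n s| ≤ n := by
  have h0 : 0 ≤ min |s| n := le_min (abs_nonneg s) hn
  rw [clip, abs_mul, abs_of_nonneg h0]
  exact (mul_le_of_le_one_left h0 (abs_sign_le_one s)).trans (min_le_right _ _)

/-- The two differ only where |s| > n, and there |s| - n ≤ |s| ≤ s²/n. -/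
lemma abs_clip_sub_le {n : ℝ} (hn : 0 < n) (s : ℝ) : |clip n s - s| ≤ s ^ 2 / n := by
  rw [le_div_iff₀ hn, ← sq_abs s]
  rcases lt_trichotomy s 0 with h | h | h
  · rw [clip, Real.sign_of_neg h, abs_of_neg h]
    rcases le_total (-s) n with h1 | h1
    · rw [min_eq_left h1]; simp; positivity
    · rw [min_eq_right h1, abs_of_nonneg (by linarith)]; nlinarith
  · simp [h, clip]
  · rw [clip, Real.sign_of_pos h, abs_of_pos h]
    rcases le_total s n with h1 | h1
    · rw [min_eq_left h1]; simp; positivity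
    · rw [min_eq_right h1, abs_of_nonpos (by linarith)]; nlinarith

lemma measurable_clip (n : ℝ) : Measurable (clip n) := by
  unfold clip
  refine Measurable.mul ?_ (by fun_prop)
  unfold Real.sign
  exact Measurable.ite measurableSet_Iio measurable_const
    (Measurable.ite measurableSet_Ioi measurable_const measurable_const)

/-- Here p is the probability of an outer range and f + μF the error on it. For μ ≥ 0 the error is
at most λ + μ and p at most w/(λ + μ)². For -λ/2 ≤ μ ≤ 0 the error is at most 1 and p is O(λ^{-2}).
For μ ≤ -λ/2 the error itself is O(1/|μ|). With F = Φ(μ) this handles the lower range; replacing μ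
by -μ and F by 1 - Φ(μ) handles the upper one. -/
lemma tail_term_le {p w μ lam F f : ℝ} (hlam : 1 ≤ lam) (hp0 : 0 ≤ p) (hp1 : p ≤ 1)
    (hw : 0 ≤ w) (hp : -lam ≤ μ → p * (lam + μ) ^ 2 ≤ w) (hF0 : 0 ≤ F) (hF1 : F ≤ 1)
    (hF : μ ≤ 0 → F * μ ^ 2 ≤ 1) (hf0 : 0 ≤ f) (hf1 : f ≤ 1) (hf : f * μ ^ 2 ≤ 2) :
    p * |f + μ * F| ≤ (4 * w + 8) / lam := by
  have hl0 : 0 < lam := by linarith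
  rw [le_div_iff₀ hl0]
  rcases le_total 0 μ with h | h
  · have h1 := hp (by linarith)
    have h2 : |f + μ * F| ≤ lam + μ := by
      rw [abs_of_nonneg (by positivity)]
      nlinarith
    calc p * |f + μ * F| * lam ≤ p * (lam + μ) * (lam + μ) := by gcongr; linarith
      _ = p * (lam + μ) ^ 2 := by ring
      _ ≤ _ := by linarith
  · have hF' := hF h
    have hneg : |f + μ * F| ≤ max f (-μ * F) := by
      rw [abs_le]
      have h3 : 0 ≤ -μ * F := mul_nonneg (by linarith) hF0
      constructor
      · have := le_max_right f (-μ * F); linarith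
      · have := le_max_left f (-μ * F); linarith
    rcases le_total (-(lam / 2)) μ with h2 | h2
    · have h1 := hp (by linarith)
      have h4 : p * (lam / 2) ^ 2 ≤ w := by
        refine le_trans ?_ h1
        gcongr
        linarith
      have h5 : |f + μ * F| ≤ 1 := by
        refine hneg.trans (max_le hf1 ?_)
        rcases le_total (-μ) 1 with h6 | h6 <;> nlinarith
      calc p * |f + μ * F| * lam ≤ p * 1 * (lam * lam) := by
            gcongr; nlinarith
        _ = 4 * (p * (lam / 2) ^ 2) := by ring
        _ ≤ _ := by linarith
    · have hμ : 1 / 2 ≤ -μ := by linarith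
      have h5 : |f + μ * F| * lam ≤ 8 := by
        have h6 : lam ≤ 2 * (-μ) := by linarith
        calc |f + μ * F| * lam ≤ max f (-μ * F) * (2 * (-μ)) := by
              gcongr
          _ ≤ 8 := by
            rcases max_choice f (-μ * F) with h7 | h7 <;> rw [h7] <;> nlinarith
      calc p * |f + μ * F| * lam = p * (|f + μ * F| * lam) := by ring
        _ ≤ 1 * 8 := by gcongr
        _ ≤ _ := by linarith

lemma stdPDF_mul_sq_le (μ : ℝ) : stdPDF μ * μ ^ 2 ≤ 2 := by
  rw [stdPDF_eq]
  have h1 : μ ^ 2 / 2 * Real.exp (-(μ ^ 2 / 2)) ≤ 1 := by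
    rw [Real.exp_neg, ← div_eq_mul_inv, div_le_one (Real.exp_pos _)]
    linarith [Real.add_one_le_exp (μ ^ 2 / 2)]
  have h0 : 0 ≤ μ ^ 2 / 2 * Real.exp (-(μ ^ 2 / 2)) := by positivity
  nlinarith [stdPDF_nonneg 0, stdPDF_zero_le_one]

lemma stdCDF_mul_sq_le {μ : ℝ} (h : μ ≤ 0) : stdCDF μ * μ ^ 2 ≤ 1 := by
  rw [stdCDF, cdf_eq_real]
  have := gaussianReal_mul_sq_le 0 1 (s := Set.Iic μ) (t := -μ) (by linarith) fun x hx => by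
    rw [sub_zero]
    exact (neg_le_neg hx).trans (neg_le_abs x)
  simpa using this

lemma one_sub_stdCDF_mul_sq_le {μ : ℝ} (h : 0 ≤ μ) : (1 - stdCDF μ) * μ ^ 2 ≤ 1 := by
  rw [stdCDF, cdf_eq_real, ← probReal_compl_eq_one_sub measurableSet_Iic, Set.compl_Iic]
  have := gaussianReal_mul_sq_le 0 1 (s := Set.Ioi μ) (t := μ) h fun x hx => by
    rw [sub_zero]
    exact (le_of_lt hx).trans (le_abs_self x)
  simpa using this

lemma gaussianReal_Iio_mul_sq_le (μ : ℝ) (v : ℝ≥0) {lam : ℝ} (h : -lam ≤ μ) :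
    (gaussianReal μ v).real (Set.Iio (-lam)) * (lam + μ) ^ 2 ≤ v :=
  gaussianReal_mul_sq_le μ v (by linarith) fun x hx => by
    have : x < -lam := hx
    rw [abs_sub_comm]
    exact le_trans (by linarith) (le_abs_self _)

lemma gaussianReal_Ioi_mul_sq_le (μ : ℝ) (v : ℝ≥0) {lam : ℝ} (h : μ ≤ lam) :
    (gaussianReal μ v).real (Set.Ioi lam) * (lam - μ) ^ 2 ≤ v :=
  gaussianReal_mul_sq_le μ v (by linarith) fun x hx => by
    have : lam < x := hx
    exact le_trans (by linarith) (le_abs_self _)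

lemma gaussianReal_Icc_mul_sq_le (μ : ℝ) (v : ℝ≥0) {lam : ℝ} (h : lam ≤ |μ|) :
    (gaussianReal μ v).real (Set.Icc (-lam) lam) * (|μ| - lam) ^ 2 ≤ v :=
  gaussianReal_mul_sq_le μ v (by linarith) fun x hx => by
    have : |x| ≤ lam := abs_le.2 hx
    rw [abs_sub_comm]
    linarith [abs_sub_abs_le_abs_sub μ x]

/-! ### Bias and variance of the switching estimate. -/

/-- The threshold estimate with a general central part. -/
def switchEst (β lam : ℝ) (s : ℝ → ℝ) (p : ℝ × ℝ) : ℝ :=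
  if p.2 < -lam then -(β * p.1) else if p.2 ≤ lam then s p.1 else (1 - β) * p.1

lemma integrable_clip_hermiteSum (e : ℕ → ℝ) (μ : ℝ) (v : ℝ≥0) (N : ℕ) {n : ℝ} (hn : 0 ≤ n) :
    Integrable (fun u => clip n (hermiteSum e v N u)) (gaussianReal μ v) :=
  (integrable_hermiteSum e μ v N).mono
    ((measurable_clip n).comp (measurable_hermiteSum e v N)).aestronglyMeasurable
    (ae_of_all _ fun _ => abs_clip_le_abs hn _)

lemma Icc_mul_integral_sq_le {e : ℕ → ℝ} (he : ∀ k, e k ^ 2 * k.factorial ≤ 1) (μ : ℝ)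
    (v : ℝ≥0) (N : ℕ) {w lam : ℝ} (hw : 0 < w) (hw5 : w ≤ 1 / 5) (hv : (v : ℝ) ≤ w)
    (hlam : 0 ≤ lam) :
    (gaussianReal μ v).real (Set.Icc (-lam) lam) *
      ∫ u, hermiteSum e v N u ^ 2 ∂gaussianReal μ v ≤ (N : ℝ) ^ 2 * Real.exp (5 / 2 * lam ^ 2) := by
  calc _ ≤ (gaussianReal μ v).real (Set.Icc (-lam) lam) *
        ((N : ℝ) ^ 2 * Real.exp (μ ^ 2 / (1 - v))) := by
        gcongr
        exact integral_hermiteSum_sq_le he μ v (by linarith) N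
    _ = (N : ℝ) ^ 2 * ((gaussianReal μ v).real (Set.Icc (-lam) lam) *
        Real.exp (μ ^ 2 / (1 - v))) := by ring
    _ ≤ _ := by
        gcongr
        exact gaussianReal_Icc_mul_exp_le μ v hw hw5 hv hlam

lemma sq_integral_hermiteSum_le (e : ℕ → ℝ) (μ : ℝ) (v : ℝ≥0) (N : ℕ) :
    (∫ u, hermiteSum e v N u ∂gaussianReal μ v) ^ 2 ≤
      ∫ u, hermiteSum e v N u ^ 2 ∂gaussianReal μ v := by
  have hm : MemLp (hermiteSum e v N) 2 (gaussianReal μ v) :=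
    (memLp_two_iff_integrable_sq (measurable_hermiteSum e v N).aestronglyMeasurable).2
      (integrable_hermiteSum_sq e μ v N)
  have h := variance_nonneg (hermiteSum e v N) (gaussianReal μ v)
  rw [variance_eq_sub hm] at h
  simpa using h

lemma abs_G_le {β : ℝ} (h0 : 0 ≤ β) (h1 : β ≤ 1) (μ : ℝ) : |G μ β| ≤ 1 + |μ| := by
  have e : G μ β = stdPDF μ + μ * (stdCDF μ - β) := by rw [G]; ring
  rw [e]
  refine (abs_add_le _ _).trans (add_le_add ?_ ?_)
  · rw [abs_of_nonneg (stdPDF_nonneg μ)]; exact stdPDF_le_one μ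
  · rw [abs_mul]
    refine mul_le_of_le_one_right (abs_nonneg μ) (abs_le.2 ⟨?_, ?_⟩)
    · linarith [stdCDF_nonneg μ]
    · linarith [stdCDF_le_one μ]

/-- When μ is at distance at least D outside [-λ, λ], nothing is asked of the Taylor approximation:
the small probability of the central range pays for both E S and G. -/
lemma central_far_le {β : ℝ} (h0 : 0 ≤ β) (h1 : β ≤ 1) (μ : ℝ) (v : ℝ≥0) {M : ℕ}
    {w lam D : ℝ} (hw : 0 < w) (hw5 : w ≤ 1 / 5) (hv : (v : ℝ) ≤ w)
    (hlam : 0 ≤ lam) (hD : 0 < D) (hμ : lam + D ≤ |μ|) :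
    (gaussianReal μ v).real (Set.Icc (-lam) lam) *
      |∫ u, hermiteSum (taylorCoef β) v (M + 2) u ∂gaussianReal μ v - G μ β| ≤
    ((M : ℝ) + 2) * √(Real.exp (-(D ^ 2 / (2 * w))) * Real.exp (5 / 2 * lam ^ 2)) +
      Real.exp (-(D ^ 2 / (2 * w))) + w / D + lam * w / D ^ 2 := by
  set p := (gaussianReal μ v).real (Set.Icc (-lam) lam) with hp
  set I := ∫ u, hermiteSum (taylorCoef β) v (M + 2) u ∂gaussianReal μ v
  have hp0 : 0 ≤ p := measureReal_nonneg
  have hq := gaussianReal_Icc_le μ v (lam := lam) (t := D) hw hv hD.le (by linarith)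
  have hE := Icc_mul_integral_sq_le (taylorCoef_sq_mul_factorial_le h0 h1) μ v (M + 2) hw hw5 hv
    hlam
  have hI := sq_integral_hermiteSum_le (taylorCoef β) μ v (M + 2)
  rw [← hp] at hq hE
  set q := Real.exp (-(D ^ 2 / (2 * w)))
  set E := Real.exp (5 / 2 * lam ^ 2)
  have hE0 : 0 ≤ E := (Real.exp_pos _).le
  have hq0 : 0 ≤ q := (Real.exp_pos _).le
  -- Spend one factor p on its bound q and the other on p I² ≤ (M + 2)² E.
  have hA : p * |I| ≤ ((M : ℝ) + 2) * √(q * E) := by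
    refine abs_le_of_sq_le_sq' ?_ (by positivity) |>.2
    rw [mul_pow, sq_abs, mul_pow, Real.sq_sqrt (by positivity)]
    push_cast at hE
    calc p ^ 2 * I ^ 2 = p * (p * I ^ 2) := by ring
      _ ≤ q * (((M : ℝ) + 2) ^ 2 * E) := by
        refine mul_le_mul hq ?_ (by positivity) hq0
        exact (mul_le_mul_of_nonneg_left hI hp0).trans hE
      _ = _ := by ring
  have hC := gaussianReal_Icc_mul_sq_le μ v (lam := lam) (by linarith)
  rw [← hp] at hC
  have hB : p * |G μ β| ≤ q + w / D + lam * w / D ^ 2 := by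
    set t := |μ| - lam with ht
    have htD : D ≤ t := by linarith
    have ht0 : 0 ≤ t := by linarith
    have hpt : p * t ≤ w / D := by
      rw [le_div_iff₀ hD]
      calc p * t * D ≤ p * t * t := by gcongr
        _ = p * t ^ 2 := by ring
        _ ≤ w := hC.trans hv
    have hpl : p * lam ≤ lam * w / D ^ 2 := by
      rw [le_div_iff₀ (by positivity)]
      calc p * lam * D ^ 2 ≤ p * lam * t ^ 2 := by gcongr
        _ = lam * (p * t ^ 2) := by ring
        _ ≤ lam * w := by gcongr; exact hC.trans hv
    calc p * |G μ β| ≤ p * (1 + |μ|) := by gcongr; exact abs_G_le h0 h1 μ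
      _ = p + p * t + p * lam := by rw [ht]; ring
      _ ≤ _ := by linarith
  calc p * |I - G μ β| ≤ p * (|I| + |G μ β|) := by gcongr; exact abs_sub _ _
    _ ≤ _ := by rw [mul_add]; linarith

/-- The four groups of terms come from the two outer ranges, the truncation at n, the Taylor
remainder for |μ| ≤ λ + D, and the far case |μ| ≥ λ + D. -/
theorem abs_bias_switchEst_le {β : ℝ} (h0 : 0 ≤ β) (h1 : β ≤ 1) (μ : ℝ) (v : ℝ≥0) {M : ℕ}
    {w lam D n : ℝ} (hn : 0 < n) (hw : 0 < w) (hw5 : w ≤ 1 / 5) (hv : (v : ℝ) ≤ w)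
    (hlam : 1 ≤ lam) (hD : 0 < D) (hM : Real.exp 1 ^ 2 * (lam + D) ^ 2 ≤ M) :
    |∫ p, switchEst β lam (fun u => clip n (hermiteSum (taylorCoef β) v (M + 2) u)) p
        ∂(gaussianReal μ v).prod (gaussianReal μ v) - G μ β| ≤
      2 * ((4 * w + 8) / lam) + ((M : ℝ) + 2) ^ 2 * Real.exp (5 / 2 * lam ^ 2) / n +
      (lam + D) ^ 2 * Real.exp (-(M / 4 : ℝ)) +
      (((M : ℝ) + 2) * √(Real.exp (-(D ^ 2 / (2 * w))) * Real.exp (5 / 2 * lam ^ 2)) +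
      Real.exp (-(D ^ 2 / (2 * w))) + w / D + lam * w / D ^ 2) := by
  have hlam0 : 0 ≤ lam := by linarith
  set ν := gaussianReal μ v with hν
  set S := hermiteSum (taylorCoef β) v (M + 2) with hS
  have hclip := integrable_clip_hermiteSum (taylorCoef β) μ v (M + 2) hn.le
  have hSi := integrable_hermiteSum (taylorCoef β) μ v (M + 2)
  have hid := integrable_id_gaussianReal μ v
  have hT := integral_threshold ν hlam0 (f := fun x => -(β * x)) (hid.const_mul β).neg hclip
    (hid.const_mul (1 - β))
  have hone := real_Iio_add_Icc_add_Ioi ν hlam0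
  rw [integral_neg, integral_const_mul, integral_const_mul, hν, integral_id_gaussianReal,
    ← hν] at hT
  unfold switchEst
  rw [hT]
  set pA := ν.real (Set.Iio (-lam)) with hpA
  set pB := ν.real (Set.Icc (-lam) lam) with hpB
  set pC := ν.real (Set.Ioi lam) with hpC
  have hA0 : 0 ≤ pA := measureReal_nonneg
  have hB0 : 0 ≤ pB := measureReal_nonneg
  have hC0 : 0 ≤ pC := measureReal_nonneg
  have tA : pA * |stdPDF μ + μ * stdCDF μ| ≤ (4 * w + 8) / lam :=
    tail_term_le hlam hA0 (by linarith) hw.le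
      (fun h => (gaussianReal_Iio_mul_sq_le μ v h).trans hv) (stdCDF_nonneg μ) (stdCDF_le_one μ)
      stdCDF_mul_sq_le (stdPDF_nonneg μ) (stdPDF_le_one μ) (stdPDF_mul_sq_le μ)
  have tC : pC * |stdPDF μ + -μ * (1 - stdCDF μ)| ≤ (4 * w + 8) / lam :=
    tail_term_le hlam hC0 (by linarith) hw.le
      (fun h => by
        rw [← sub_eq_add_neg]
        exact (gaussianReal_Ioi_mul_sq_le μ v (by linarith)).trans hv)
      (by linarith [stdCDF_le_one μ]) (by linarith [stdCDF_nonneg μ])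
      (fun h => by rw [neg_sq]; exact one_sub_stdCDF_mul_sq_le (by linarith)) (stdPDF_nonneg μ)
      (stdPDF_le_one μ) (by rw [neg_sq]; exact stdPDF_mul_sq_le μ)
  have tB1 : pB * |∫ u, clip n (S u) ∂ν - ∫ u, S u ∂ν| ≤
      ((M : ℝ) + 2) ^ 2 * Real.exp (5 / 2 * lam ^ 2) / n := by
    have hE := Icc_mul_integral_sq_le (taylorCoef_sq_mul_factorial_le h0 h1) μ v (M + 2) hw hw5 hv
      hlam0
    push_cast at hE
    have h2 : |∫ u, clip n (S u) ∂ν - ∫ u, S u ∂ν| ≤ (∫ u, S u ^ 2 ∂ν) / n := by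
      rw [← integral_sub hclip hSi, ← integral_div]
      refine (abs_integral_le_integral_abs).trans (integral_mono (hclip.sub hSi).abs
        ((integrable_hermiteSum_sq _ μ v _).div_const n) fun u => abs_clip_sub_le hn _)
    calc _ ≤ pB * ((∫ u, S u ^ 2 ∂ν) / n) := by gcongr
      _ = (pB * ∫ u, S u ^ 2 ∂ν) / n := by ring
      _ ≤ _ := by gcongr
  have tB2 : pB * |∫ u, S u ∂ν - G μ β| ≤ (lam + D) ^ 2 * Real.exp (-(M / 4 : ℝ)) +
      (((M : ℝ) + 2) * √(Real.exp (-(D ^ 2 / (2 * w))) * Real.exp (5 / 2 * lam ^ 2)) +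
      Real.exp (-(D ^ 2 / (2 * w))) + w / D + lam * w / D ^ 2) := by
    rcases le_total |μ| (lam + D) with h | h
    · have hR := abs_sum_taylorCoef_sub_G_le β M h hM
      rw [hS, hν, integral_hermiteSum]
      have : pB * |∑ k ∈ Finset.range (M + 2), taylorCoef β k * μ ^ k - G μ β| ≤
          (lam + D) ^ 2 * Real.exp (-(M / 4 : ℝ)) :=
        (mul_le_of_le_one_left (abs_nonneg _) (by linarith)).trans hR
      refine this.trans (le_add_of_nonneg_right (by positivity))
    · have := central_far_le h0 h1 μ v (M := M) hw hw5 hv hlam0 hD h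
      refine this.trans (le_add_of_nonneg_left (by positivity))
  -- Distribute G over the three probabilities, whose sum is 1; on the outer ranges G + βμ = φ + μΦ
  -- and G - (1 - β)μ = φ - μ(1 - Φ).
  have e : pA * -(β * μ) + pB * ∫ u, clip n (S u) ∂ν + pC * ((1 - β) * μ) - G μ β =
      -(pA * (stdPDF μ + μ * stdCDF μ)) - pC * (stdPDF μ + -μ * (1 - stdCDF μ)) +
        pB * (∫ u, clip n (S u) ∂ν - ∫ u, S u ∂ν) + pB * (∫ u, S u ∂ν - G μ β) := by
    rw [G]
    linear_combination (stdPDF μ + μ * stdCDF μ - β * μ) * hone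
  rw [e]
  rw [← abs_of_nonneg hA0, ← abs_mul] at tA
  rw [← abs_of_nonneg hC0, ← abs_mul] at tC
  rw [← abs_of_nonneg hB0, ← abs_mul] at tB1 tB2
  rw [abs_le] at tA tC tB1 tB2 ⊢
  constructor <;> linarith [tA.1, tA.2, tC.1, tC.2, tB1.1, tB1.2, tB2.1, tB2.2]

lemma measurable_switchEst {s : ℝ → ℝ} (hs : Measurable s) (β lam : ℝ) :
    Measurable (switchEst β lam s) := by
  unfold switchEst
  exact Measurable.ite (measurableSet_lt measurable_snd measurable_const) (by fun_prop)
    (Measurable.ite (measurableSet_le measurable_snd measurable_const)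
      (hs.comp measurable_fst) (by fun_prop))

lemma memLp_switchEst {β lam n : ℝ} (h0 : 0 ≤ β) (h1 : β ≤ 1) (hn : 0 ≤ n) {s : ℝ → ℝ}
    (hs : Measurable s) (hsn : ∀ u, |s u| ≤ n) (μ : ℝ) (v : ℝ≥0) :
    MemLp (switchEst β lam s) 2 ((gaussianReal μ v).prod (gaussianReal μ v)) := by
  have hid : MemLp (fun p : ℝ × ℝ => |p.1| + n) 2
      ((gaussianReal μ v).prod (gaussianReal μ v)) :=
    MemLp.add (MemLp.comp_fst ((memLp_id_gaussianReal 2).norm) _) (memLp_const n)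
  refine hid.mono (measurable_switchEst hs β lam).aestronglyMeasurable (ae_of_all _ fun p => ?_)
  rw [Real.norm_eq_abs, Real.norm_eq_abs]
  refine le_trans ?_ (le_abs_self _)
  have hp := abs_nonneg p.1
  unfold switchEst
  split_ifs
  · rw [abs_neg, abs_mul, abs_of_nonneg h0]
    have := mul_le_of_le_one_left hp h1
    linarith
  · linarith [hsn p.1]
  · rw [abs_mul, abs_of_nonneg (sub_nonneg.2 h1)]
    have := mul_le_of_le_one_left hp (show 1 - β ≤ 1 by linarith)
    linarith

/-- The variance is at most the second moment about any a. Taking a to be the mean of the outer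
branch on the side of μ leaves only noise there; on the opposite side the offset is ±μ, which
Chebyshev controls. -/
theorem variance_switchEst_le {β : ℝ} (h0 : 0 ≤ β) (h1 : β ≤ 1) (μ : ℝ) (v : ℝ≥0) {M : ℕ}
    {w lam n : ℝ} (hn : 0 ≤ n) (hw : 0 < w) (hw5 : w ≤ 1 / 5) (hv : (v : ℝ) ≤ w)
    (hlam : 0 ≤ lam) :
    Var[switchEst β lam (fun u => clip n (hermiteSum (taylorCoef β) v (M + 2) u));
        (gaussianReal μ v).prod (gaussianReal μ v)] ≤
      2 * (((M : ℝ) + 2) ^ 2 * Real.exp (5 / 2 * lam ^ 2)) + 8 * lam ^ 2 + 12 * w := by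
  set ν := gaussianReal μ v with hν
  set S := hermiteSum (taylorCoef β) v (M + 2) with hS
  set T := switchEst β lam (fun u => clip n (S u)) with hT
  set a : ℝ := if 0 ≤ μ then (1 - β) * μ else -(β * μ) with ha
  have haμ : a ^ 2 ≤ μ ^ 2 := by
    rw [ha]
    split_ifs
    · rw [mul_pow]
      exact mul_le_of_le_one_left (sq_nonneg μ) (by nlinarith)
    · rw [neg_sq, mul_pow]
      exact mul_le_of_le_one_left (sq_nonneg μ) (by nlinarith)
  have hmeas : Measurable (fun u => clip n (S u)) :=
    (measurable_clip n).comp (measurable_hermiteSum _ _ _)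
  have hTm : Measurable T := measurable_switchEst hmeas β lam
  have hclip := integrable_clip_hermiteSum (taylorCoef β) μ v (M + 2) hn
  have hSsq := integrable_hermiteSum_sq (taylorCoef β) μ v (M + 2)
  have hclip2 : Integrable (fun u => (clip n (S u) - a) ^ 2) ν := by
    refine (hSsq.const_mul 2).add (integrable_const (2 * a ^ 2)) |>.mono
      ((hmeas.sub_const a).pow_const 2).aestronglyMeasurable (ae_of_all _ fun u => ?_)
    rw [Real.norm_eq_abs, Real.norm_eq_abs, abs_of_nonneg (sq_nonneg _)]
    refine le_trans ?_ (le_abs_self _)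
    have := sq_le_sq.2 (abs_clip_le_abs hn (S u))
    simp only [Pi.add_apply]
    nlinarith [sq_nonneg (clip n (S u) + a)]
  have hint := integral_threshold ν hlam (integrable_affine_sq μ v (-β) (-a)) hclip2
    (integrable_affine_sq μ v (1 - β) (-a))
  rw [hν, integral_affine_sq, integral_affine_sq, ← hν] at hint
  have e : (fun p : ℝ × ℝ => (T p - a) ^ 2) = fun p => if p.2 < -lam then (-β * p.1 + -a) ^ 2 else
      if p.2 ≤ lam then (clip n (S p.1) - a) ^ 2 else ((1 - β) * p.1 + -a) ^ 2 := by
    ext p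
    rw [hT]
    unfold switchEst
    split_ifs <;> ring
  have hvar : Var[T; ν.prod ν] ≤ ∫ p, (T p - a) ^ 2 ∂ν.prod ν := by
    rw [← variance_sub_const hTm.aestronglyMeasurable a]
    exact variance_le_expectation_sq (hTm.sub_const a).aestronglyMeasurable
  refine hvar.trans ?_
  rw [e, hint]
  have hone := real_Iio_add_Icc_add_Ioi ν hlam
  have hE := Icc_mul_integral_sq_le (taylorCoef_sq_mul_factorial_le h0 h1) μ v (M + 2) hw hw5 hv
    hlam
  push_cast at hE
  have hAc := fun h => (gaussianReal_Iio_mul_sq_le μ v (lam := lam) h).trans hv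
  have hCc := fun h => (gaussianReal_Ioi_mul_sq_le μ v (lam := lam) h).trans hv
  have hBc := fun h => (gaussianReal_Icc_mul_sq_le μ v (lam := lam) h).trans hv
  rw [← hν] at hE hAc hCc hBc
  set pA := ν.real (Set.Iio (-lam)) with hpA
  set pB := ν.real (Set.Icc (-lam) lam) with hpB
  set pC := ν.real (Set.Ioi lam) with hpC
  have hA0 : 0 ≤ pA := measureReal_nonneg
  have hB0 : 0 ≤ pB := measureReal_nonneg
  have hC0 : 0 ≤ pC := measureReal_nonneg
  have hA1 : pA ≤ 1 := by linarith
  have hB1 : pB ≤ 1 := by linarith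
  have hC1 : pC ≤ 1 := by linarith
  have hv0 : (0 : ℝ) ≤ v := v.2
  have hβv : ∀ c : ℝ, 0 ≤ c → c ≤ 1 → c ^ 2 * (v : ℝ) ≤ w := fun c hc0 hc1 =>
    (mul_le_of_le_one_left hv0 (by nlinarith)).trans hv
  have tA : pA * ((-β) ^ 2 * v + (-β * μ + -a) ^ 2) ≤ 2 * w := by
    have h2 : pA * (-β * μ + -a) ^ 2 ≤ w := by
      rw [ha]
      split_ifs with hμ
      · calc _ = pA * μ ^ 2 := by ring
          _ ≤ pA * (lam + μ) ^ 2 := by gcongr; linarith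
          _ ≤ w := hAc (by linarith)
      · ring_nf; exact hw.le
    have h3 : pA * ((-β) ^ 2 * v) ≤ w := by
      rw [neg_sq]
      exact (mul_le_of_le_one_left (by positivity) hA1).trans (hβv β h0 h1)
    rw [mul_add]; linarith
  have tC : pC * ((1 - β) ^ 2 * v + ((1 - β) * μ + -a) ^ 2) ≤ 2 * w := by
    have h2 : pC * ((1 - β) * μ + -a) ^ 2 ≤ w := by
      rw [ha]
      split_ifs with hμ
      · ring_nf; exact hw.le
      · have hμ' : μ ≤ 0 := (not_le.1 hμ).le
        calc _ = pC * (-μ) ^ 2 := by ring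
          _ ≤ pC * (lam - μ) ^ 2 := by gcongr <;> linarith
          _ ≤ w := hCc (by linarith)
    have h3 : pC * ((1 - β) ^ 2 * v) ≤ w :=
      (mul_le_of_le_one_left (by positivity) hC1).trans (hβv _ (by linarith) (by linarith))
    rw [mul_add]; linarith
  -- Either |μ| ≤ 2λ, or |μ| ≤ 2(|μ| - λ) and Chebyshev applies.
  have tμ : pB * μ ^ 2 ≤ 4 * lam ^ 2 + 4 * w := by
    rcases le_total |μ| (2 * lam) with h | h
    · have : μ ^ 2 ≤ 4 * lam ^ 2 := by
        calc μ ^ 2 = |μ| ^ 2 := (sq_abs μ).symm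
          _ ≤ (2 * lam) ^ 2 := by gcongr
          _ = _ := by ring
      have := mul_le_of_le_one_left (sq_nonneg μ) hB1
      linarith
    · have h2 := hBc (by linarith)
      have h3 : μ ^ 2 ≤ 4 * (|μ| - lam) ^ 2 := by
        calc μ ^ 2 = |μ| ^ 2 := (sq_abs μ).symm
          _ ≤ (2 * (|μ| - lam)) ^ 2 := by gcongr; linarith
          _ = _ := by ring
      have := mul_le_mul_of_nonneg_left h3 hB0
      have := sq_nonneg lam
      linarith
  have tB : pB * ∫ u, (clip n (S u) - a) ^ 2 ∂ν ≤
      2 * (((M : ℝ) + 2) ^ 2 * Real.exp (5 / 2 * lam ^ 2)) + 8 * lam ^ 2 + 8 * w := by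
    have h4 : ∫ u, (clip n (S u) - a) ^ 2 ∂ν ≤ 2 * (∫ u, S u ^ 2 ∂ν) + 2 * a ^ 2 := by
      have h5 : ∫ u, (2 * S u ^ 2 + 2 * a ^ 2) ∂ν = 2 * (∫ u, S u ^ 2 ∂ν) + 2 * a ^ 2 := by
        rw [integral_add (hSsq.const_mul 2) (integrable_const _), integral_const_mul]
        simp
        rfl
      rw [← h5]
      refine integral_mono hclip2 ((hSsq.const_mul 2).add (integrable_const _)) fun u => ?_
      have := sq_le_sq.2 (abs_clip_le_abs hn (S u))
      simp only
      nlinarith [sq_nonneg (clip n (S u) + a)]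
    have h6 := mul_le_mul_of_nonneg_left h4 hB0
    have h7 := mul_le_mul_of_nonneg_left haμ hB0
    linarith
  linarith

/-! ### Transfer to the estimate of one coordinate. -/

/-- The law of the estimate reduces to a product of two normal laws. -/
lemma thresholdEst_eq_switchEst {σp : ℝ} (hσ : 0 < σp) (γ σf β : ℝ) (n : ℕ) (τ : ℝ≥0∞)
    (p : ℝ × ℝ) :
    thresholdEst γ σp σf β n τ p.1 p.2 = switchEst β (threshold γ n) (fun u => clip n
      (hermiteSum (taylorCoef β) ((2 * σp * coefD σp σf τ ^ 2).toNNReal : ℝ)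
        (truncOrder γ σp σf n - 1 + 2) u))
      (coefC σp σf β τ + coefD σp σf τ * (p.1 + √σp * p.2),
        coefC σp σf β τ + coefD σp σf τ * (p.1 - √σp * p.2)) := by
  have hv : ((2 * σp * coefD σp σf τ ^ 2).toNNReal : ℝ) = 2 * σp * coefD σp σf τ ^ 2 :=
    Real.coe_toNNReal _ (by positivity)
  simp only [hv, hermiteSum, ← seriesEst_eq_sum hσ]
  rfl

lemma shrink_mem_Icc {σp : ℝ} (hσ : 0 < σp) (τ : ℝ≥0∞) : shrink σp τ ∈ Set.Icc (0 : ℝ) 1 := by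
  unfold shrink
  split_ifs
  · simp
  · have := ENNReal.toReal_nonneg (a := τ)
    exact ⟨by positivity, by rw [div_le_one (by positivity)]; linarith⟩

/-- Since 0 ≤ α ≤ 1, the numerator (1 - α)² is at most 1 and the denominator at least σf, so the
bound is free of τ. -/
lemma variance_coef_le {σp σf : ℝ} (hσ : 0 < σp) (hf : 0 < σf) (τ : ℝ≥0∞) :
    ((2 * σp * coefD σp σf τ ^ 2).toNNReal : ℝ) ≤ 2 * σp / σf := by
  rw [Real.coe_toNNReal _ (by positivity)]
  obtain ⟨h0, h1⟩ := shrink_mem_Icc hσ τ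
  have hpos : 0 < σf + σp * shrink σp τ ^ 2 := by positivity
  rw [coefD, neg_sq, div_pow, Real.sq_sqrt hpos.le, div_eq_mul_one_div (2 * σp) σf]
  gcongr
  · nlinarith
  · nlinarith [mul_nonneg hσ.le (sq_nonneg (shrink σp τ))]

lemma integral_thresholdEst {σp : ℝ} (hσ : 0 < σp) (γ σf β θ : ℝ) (n : ℕ) (τ : ℝ≥0∞) :
    ∫ p, thresholdEst γ σp σf β n τ p.1 p.2 ∂coordLaw σp θ =
      ∫ p, switchEst β (threshold γ n) (fun u => clip n
        (hermiteSum (taylorCoef β) ((2 * σp * coefD σp σf τ ^ 2).toNNReal : ℝ)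
          (truncOrder γ σp σf n - 1 + 2) u)) p
        ∂(gaussianReal (coefC σp σf β τ + coefD σp σf τ * θ)
            (2 * σp * coefD σp σf τ ^ 2).toNNReal).prod
          (gaussianReal (coefC σp σf β τ + coefD σp σf τ * θ)
            (2 * σp * coefD σp σf τ ^ 2).toNNReal) := by
  simp_rw [thresholdEst_eq_switchEst hσ]
  rw [← map_split_coordLaw hσ, integral_map (by fun_prop)]
  exact (measurable_switchEst ((measurable_clip _).comp (measurable_hermiteSum _ _ _))
    _ _).aestronglyMeasurable

lemma estVar_eq {σp : ℝ} (hσ : 0 < σp) (γ σf β θ : ℝ) (n : ℕ) (τ : ℝ≥0∞) :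
    estVar γ σp σf β n τ θ =
      Var[switchEst β (threshold γ n) (fun u => clip n
        (hermiteSum (taylorCoef β) ((2 * σp * coefD σp σf τ ^ 2).toNNReal : ℝ)
          (truncOrder γ σp σf n - 1 + 2) u));
        (gaussianReal (coefC σp σf β τ + coefD σp σf τ * θ)
            (2 * σp * coefD σp σf τ ^ 2).toNNReal).prod
          (gaussianReal (coefC σp σf β τ + coefD σp σf τ * θ)
            (2 * σp * coefD σp σf τ ^ 2).toNNReal)] := by
  rw [estVar, ← map_split_coordLaw hσ, variance_map ?_ (by fun_prop)]
  · congr 1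
    ext p
    exact thresholdEst_eq_switchEst hσ γ σf β n τ p
  · exact (measurable_switchEst ((measurable_clip _).comp (measurable_hermiteSum _ _ _))
      _ _).aemeasurable

theorem memLp_thresholdEst {σp β : ℝ} (hσ : 0 < σp) (h0 : 0 ≤ β) (h1 : β ≤ 1) (γ σf θ : ℝ)
    (n : ℕ) (τ : ℝ≥0∞) :
    MemLp (fun p : ℝ × ℝ => thresholdEst γ σp σf β n τ p.1 p.2) 2 (coordLaw σp θ) := by
  have hm : Measurable fun u => clip (n : ℝ)
      (hermiteSum (taylorCoef β) ((2 * σp * coefD σp σf τ ^ 2).toNNReal : ℝ)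
        (truncOrder γ σp σf n - 1 + 2) u) :=
    (measurable_clip _).comp (measurable_hermiteSum _ _ _)
  have h := memLp_switchEst (lam := threshold γ n) h0 h1 n.cast_nonneg hm
    (fun u => abs_clip_le n.cast_nonneg _) (coefC σp σf β τ + coefD σp σf τ * θ)
    (2 * σp * coefD σp σf τ ^ 2).toNNReal
  rw [← map_split_coordLaw hσ, memLp_map_measure_iff
    (measurable_switchEst hm _ _).aestronglyMeasurable (by fun_prop)] at h
  refine (memLp_congr_ae (ae_of_all _ fun p => ?_)).1 h
  exact (thresholdEst_eq_switchEst hσ γ σf β n τ p).symm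

/-! ### Rates in x = log n. -/

open Asymptotics

/-- With x = log n the factor a_n is log x, and (log x)^8 = o(x^{1/2}). -/
lemma tendsto_log_pow_mul_of_isBigO {f : ℝ → ℝ}
    (hf : f =O[atTop] fun x : ℝ => x ^ (-(1 / 2) : ℝ)) :
    Tendsto (fun x : ℝ => Real.log x ^ 8 * f x) atTop (𝓝 0) := by
  have h1 : (fun x : ℝ => Real.log x ^ 8) =o[atTop] fun x : ℝ => (x ^ (1 / 16 : ℝ)) ^ 8 :=
    (isLittleO_log_rpow_atTop (by norm_num)).pow (by norm_num)
  have h2 := h1.mul_isBigO hf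
  refine (isLittleO_one_iff ℝ).1 (h2.congr' EventuallyEq.rfl ?_)
  filter_upwards [eventually_gt_atTop (0 : ℝ)] with x hx
  rw [← Real.rpow_natCast, ← Real.rpow_mul hx.le, ← Real.rpow_add hx]
  norm_num

lemma isBigO_mul_exp_neg {p : ℝ → ℝ} {k a : ℝ} (ha : 0 < a)
    (hp : p =O[atTop] fun x : ℝ => x ^ k) :
    (fun x => p x * Real.exp (-a * x)) =O[atTop] fun x : ℝ => x ^ (-(1 / 2) : ℝ) := by
  have h := hp.mul (isLittleO_exp_neg_mul_rpow_atTop ha (-(1 / 2) - k)).isBigO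
  refine h.congr' EventuallyEq.rfl ?_
  filter_upwards [eventually_gt_atTop (0 : ℝ)] with x hx
  rw [← Real.rpow_add hx]
  ring_nf

lemma isBigO_affine (a b : ℝ) : (fun x : ℝ => a * x + b) =O[atTop] fun x : ℝ => x ^ (1 : ℝ) := by
  simp only [Real.rpow_one]
  exact ((isBigO_refl _ _).const_mul_left a).add (isLittleO_const_id_atTop b).isBigO

lemma isBigO_affine_sq (a b : ℝ) :
    (fun x : ℝ => (a * x + b) ^ 2) =O[atTop] fun x : ℝ => x ^ (2 : ℝ) := by
  have := (isBigO_affine a b).pow 2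
  simpa using this

/-- Envelope of the bias in terms of `x = log n`. -/
def biasEnvelope (K c x : ℝ) : ℝ :=
  K * x ^ (-(1 / 2) : ℝ) + (c * x + 3) ^ 2 * Real.exp (-(1 / 2) * x) +
    (K * x + 0) * Real.exp (-(c / 4) * x) + (c * x + 3) * Real.exp (-(1 / 4) * x) +
    (0 * x + 1) * Real.exp (-1 * x)

/-- Envelope of the variance divided by `n` in terms of `x = log n`. -/
def varEnvelope (K c x : ℝ) : ℝ :=
  2 * ((c * x + 3) ^ 2 * Real.exp (-(1 / 2) * x)) + (K * x + K) * Real.exp (-1 * x)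

lemma tendsto_biasEnvelope (K : ℝ) {c : ℝ} (hc : 0 < c) :
    Tendsto (fun x : ℝ => Real.log x ^ 8 * biasEnvelope K c x) atTop (𝓝 0) := by
  refine tendsto_log_pow_mul_of_isBigO ?_
  unfold biasEnvelope
  refine ((((((isBigO_refl _ _).const_mul_left K).add ?_).add ?_).add ?_).add ?_)
  · exact isBigO_mul_exp_neg (by norm_num) (isBigO_affine_sq c 3)
  · exact isBigO_mul_exp_neg (by positivity) (isBigO_affine K 0)
  · exact isBigO_mul_exp_neg (by norm_num) (isBigO_affine c 3)
  · exact isBigO_mul_exp_neg (by norm_num) (isBigO_affine 0 1)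

lemma tendsto_varEnvelope (K c : ℝ) :
    Tendsto (fun x : ℝ => Real.log x ^ 8 * varEnvelope K c x) atTop (𝓝 0) := by
  refine tendsto_log_pow_mul_of_isBigO ?_
  unfold varEnvelope
  refine IsBigO.add (IsBigO.const_mul_left ?_ 2) ?_
  · exact isBigO_mul_exp_neg (by norm_num) (isBigO_affine_sq c 3)
  · exact isBigO_mul_exp_neg (by norm_num) (isBigO_affine K K)

lemma truncOrder_sub_one (γ σp σf : ℝ) (n : ℕ) : truncOrder γ σp σf n - 1 =
    ⌈Real.exp 1 ^ 2 * (γ + √(2 * σp / σf)) ^ 2 * (2 * Real.log n)⌉₊ := by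
  rw [truncOrder, Nat.add_sub_cancel_left]

theorem abs_bias_le_biasEnvelope {γ σp σf β : ℝ} (hσ : 0 < σp) (hf : 0 < σf) (h0 : 0 ≤ β)
    (h1 : β ≤ 1) (hγ : 0 < γ) (hγ2 : γ ^ 2 ≤ 1 / 10) (hw5 : 2 * σp / σf ≤ 1 / 5) :
    ∃ K c : ℝ, 0 < c ∧ ∀ n : ℕ, 1 ≤ threshold γ n → ∀ (τ : ℝ≥0∞) (θ : ℝ),
      |bias γ σp σf β n τ θ| ≤ biasEnvelope K c (Real.log n) := by
  set w := 2 * σp / σf with hw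
  have hw0 : 0 < w := by positivity
  set A := γ + √w with hA
  have hA0 : 0 < A := by positivity
  set c := Real.exp 1 ^ 2 * A ^ 2 * 2 with hc
  have hc0 : 0 < c := by positivity
  set K1 := 2 * ((4 * w + 8) / (γ * √2)) + √w / √2 + γ / √2 with hK1
  have hK1' : 0 ≤ K1 := by positivity
  -- K1 collects the (log n)^{-1/2} terms and 2A² is the coefficient of the Taylor remainder; their
  -- sum lets one constant serve both.
  refine ⟨K1 + 2 * A ^ 2, c, hc0, fun n hn τ θ => ?_⟩
  set x := Real.log n with hx
  have hx0 : 0 < x := by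
    by_contra h
    rw [threshold, ← hx, Real.sqrt_eq_zero_of_nonpos (by linarith)] at hn
    linarith
  have hn0 : (0 : ℝ) < n := by
    rcases n.eq_zero_or_pos with h | h
    · simp [hx, h] at hx0
    · exact_mod_cast h
  have hnx : (n : ℝ) = Real.exp x := (Real.exp_log hn0).symm
  set M := truncOrder γ σp σf n - 1 with hM
  have hMeq : M = ⌈c * x⌉₊ := by
    rw [hM, truncOrder_sub_one, hc, hA]
    congr 1
    ring
  have hM1 : c * x ≤ M := by rw [hMeq]; exact Nat.le_ceil _
  have hM2 : (M : ℝ) + 2 ≤ c * x + 3 := by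
    have := Nat.ceil_lt_add_one (show 0 ≤ c * x by positivity)
    rw [hMeq]; linarith
  set lam := threshold γ n with hlam
  have hs : √(2 * x) = √2 * √x := Real.sqrt_mul zero_le_two x
  have hlamx : lam = γ * √(2 * x) := rfl
  -- This choice makes D²/(2w) = log n and e²(λ + D)² = c x, the number whose ceiling is K_n - 1.
  set D := √w * √(2 * x) with hD
  have hs0 : 0 < √(2 * x) := by positivity
  have hs2 : √(2 * x) ^ 2 = 2 * x := Real.sq_sqrt (by positivity)
  have hw2 : √w ^ 2 = w := Real.sq_sqrt hw0.le
  have hD0 : 0 < D := by positivity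
  have hD2 : D ^ 2 = w * (2 * x) := by rw [hD, mul_pow, hw2, hs2]
  have hAD : lam + D = A * √(2 * x) := by rw [hlamx, hD, hA]; ring
  have hAD2 : (lam + D) ^ 2 = A ^ 2 * (2 * x) := by rw [hAD, mul_pow, hs2]
  have hB := abs_bias_switchEst_le h0 h1 (coefC σp σf β τ + coefD σp σf τ * θ)
    (2 * σp * coefD σp σf τ ^ 2).toNNReal (M := M) (n := n) hn0 hw0 hw5
    (variance_coef_le hσ hf τ) hn hD0 (by
      rw [hAD2]
      refine le_trans (le_of_eq ?_) hM1
      rw [hc]; ring)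
  rw [bias, target, integral_thresholdEst hσ]
  refine hB.trans ?_
  -- (5/2)λ² = 5γ² log n ≤ (1/2) log n, by γ² ≤ 1/10.
  have hE : Real.exp (5 / 2 * lam ^ 2) ≤ Real.exp (1 / 2 * x) := by
    refine Real.exp_le_exp.2 ?_
    rw [hlamx, mul_pow, hs2]
    nlinarith
  have hq : Real.exp (-(D ^ 2 / (2 * w))) = Real.exp (-1 * x) := by
    rw [hD2]; congr 1; field_simp
  have hsx : x ^ (-(1 / 2) : ℝ) = 1 / √x := by
    rw [Real.rpow_neg hx0.le, ← Real.sqrt_eq_rpow, one_div]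
  have hx1 : 0 < √x := by positivity
  have t1 : 2 * ((4 * w + 8) / lam) + w / D + lam * w / D ^ 2 = K1 * x ^ (-(1 / 2) : ℝ) := by
    have e1 : w / D = √w / √2 * (1 / √x) := by
      rw [hD, hs]
      nth_rewrite 1 [← hw2]
      field_simp
    have e2 : lam * w / D ^ 2 = γ / √2 * (1 / √x) := by
      rw [hD2, ← hs2, hlamx, hs]
      field_simp
    rw [e1, e2, hlamx, hs, hsx, hK1]
    field_simp
  have t2 : ((M : ℝ) + 2) ^ 2 * Real.exp (5 / 2 * lam ^ 2) / n ≤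
      (c * x + 3) ^ 2 * Real.exp (-(1 / 2) * x) := by
    rw [hnx, mul_div_assoc]
    gcongr
    rw [div_le_iff₀ (Real.exp_pos _), ← Real.exp_add]
    refine hE.trans (le_of_eq ?_)
    congr 1; ring
  have t3 : (lam + D) ^ 2 * Real.exp (-(M / 4 : ℝ)) ≤ 2 * A ^ 2 * x * Real.exp (-(c / 4) * x) := by
    rw [hAD2, show A ^ 2 * (2 * x) = 2 * A ^ 2 * x by ring]
    gcongr
    linarith
  have t4 : ((M : ℝ) + 2) * √(Real.exp (-(D ^ 2 / (2 * w))) * Real.exp (5 / 2 * lam ^ 2)) ≤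
      (c * x + 3) * Real.exp (-(1 / 4) * x) := by
    refine mul_le_mul hM2 ?_ (by positivity) (by positivity)
    rw [hq]
    refine Real.sqrt_le_iff.2 ⟨(Real.exp_pos _).le, ?_⟩
    calc _ ≤ Real.exp (-1 * x) * Real.exp (1 / 2 * x) := by gcongr
      _ = _ := by
        rw [← Real.exp_add, ← Real.exp_nat_mul]
        congr 1; push_cast; ring
  have t5 : 0 ≤ 2 * A ^ 2 * x ^ (-(1 / 2) : ℝ) := by positivity
  have t6 : 0 ≤ K1 * x * Real.exp (-(c / 4) * x) := by positivity
  rw [hq] at t4 ⊢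
  have e : biasEnvelope (K1 + 2 * A ^ 2) c x = K1 * x ^ (-(1 / 2) : ℝ) +
      2 * A ^ 2 * x ^ (-(1 / 2) : ℝ) + (c * x + 3) ^ 2 * Real.exp (-(1 / 2) * x) +
      (K1 * x * Real.exp (-(c / 4) * x) + 2 * A ^ 2 * x * Real.exp (-(c / 4) * x)) +
      (c * x + 3) * Real.exp (-(1 / 4) * x) + Real.exp (-1 * x) := by
    unfold biasEnvelope; ring
  rw [e]
  linarith only [t1, t2, t3, t4, t5, t6]

theorem estVar_le_varEnvelope {γ σp σf β : ℝ} (hσ : 0 < σp) (hf : 0 < σf) (h0 : 0 ≤ β)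
    (h1 : β ≤ 1) (hγ : 0 < γ) (hγ2 : γ ^ 2 ≤ 1 / 10) (hw5 : 2 * σp / σf ≤ 1 / 5) :
    ∃ K c : ℝ, ∀ n : ℕ, 1 ≤ n → ∀ (τ : ℝ≥0∞) (θ : ℝ),
      (n : ℝ)⁻¹ * estVar γ σp σf β n τ θ ≤ varEnvelope K c (Real.log n) := by
  set w := 2 * σp / σf with hw
  have hw0 : 0 < w := by positivity
  set c := Real.exp 1 ^ 2 * (γ + √w) ^ 2 * 2 with hc
  have hc0 : 0 < c := by positivity
  refine ⟨16 * γ ^ 2 + 12 * w, c, fun n hn τ θ => ?_⟩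
  have hn0 : (0 : ℝ) < n := by exact_mod_cast hn
  set x := Real.log n with hx
  have hx0 : 0 ≤ x := Real.log_natCast_nonneg n
  have hnx : (n : ℝ) = Real.exp x := (Real.exp_log hn0).symm
  set M := truncOrder γ σp σf n - 1 with hM
  have hM2 : (M : ℝ) + 2 ≤ c * x + 3 := by
    have := Nat.ceil_lt_add_one (show 0 ≤ c * x by positivity)
    have hMeq : M = ⌈c * x⌉₊ := by
      rw [hM, truncOrder_sub_one, hc]
      congr 1
      ring
    rw [hMeq]; linarith
  have hlam2 : threshold γ n ^ 2 = γ ^ 2 * (2 * x) := by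
    rw [threshold, mul_pow, Real.sq_sqrt (by positivity)]
  have hlam0 : 0 ≤ threshold γ n := by unfold threshold; positivity
  have hV := variance_switchEst_le h0 h1 (coefC σp σf β τ + coefD σp σf τ * θ)
    (2 * σp * coefD σp σf τ ^ 2).toNNReal (M := M) (n := n) hn0.le hw0 hw5
    (variance_coef_le hσ hf τ) hlam0
  rw [← estVar_eq hσ, hlam2] at hV
  have hE : Real.exp (5 / 2 * (γ ^ 2 * (2 * x))) ≤ Real.exp (1 / 2 * x) := by
    refine Real.exp_le_exp.2 ?_
    nlinarith
  have hninv : (n : ℝ)⁻¹ = Real.exp (-1 * x) := by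
    rw [hnx, ← Real.exp_neg]; congr 1; ring
  have hV2 : estVar γ σp σf β n τ θ ≤ 2 * ((c * x + 3) ^ 2 * Real.exp (1 / 2 * x)) +
      8 * (γ ^ 2 * (2 * x)) + 12 * w := by
    refine hV.trans ?_
    gcongr
  rw [hninv]
  calc _ ≤ Real.exp (-1 * x) * (2 * ((c * x + 3) ^ 2 * Real.exp (1 / 2 * x)) +
      8 * (γ ^ 2 * (2 * x)) + 12 * w) := by gcongr
    _ = 2 * ((c * x + 3) ^ 2 * (Real.exp (-1 * x) * Real.exp (1 / 2 * x))) +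
        (16 * γ ^ 2 * x + 12 * w) * Real.exp (-1 * x) := by ring
    _ = 2 * ((c * x + 3) ^ 2 * Real.exp (-(1 / 2) * x)) +
        (16 * γ ^ 2 * x + 12 * w) * Real.exp (-1 * x) := by
      rw [← Real.exp_add]; congr 4; ring
    _ ≤ _ := by
      unfold varEnvelope
      gcongr
      · nlinarith
      · nlinarith [sq_nonneg γ]

lemma tendsto_log_natCast : Tendsto (fun n : ℕ => Real.log n) atTop atTop :=
  Real.tendsto_log_atTop.comp tendsto_natCast_atTop_atTop

/-- With the supremum in `ℝ≥0∞`, an unbounded family would give ∞ and not a default value, so the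
uniform bound B is what yields the limit. -/
lemma tendsto_iSup_ofReal {F : ℕ → ℝ≥0∞ → ℝ → ℝ} {B : ℕ → ℝ} (hB : Tendsto B atTop (𝓝 0))
    (h : ∀ᶠ n in atTop, ∀ τ θ, F n τ θ ≤ B n) :
    Tendsto (fun n : ℕ => ⨆ (τ : ℝ≥0∞) (θ : ℝ), ENNReal.ofReal (F n τ θ)) atTop (𝓝 0) := by
  have hB' := ENNReal.tendsto_ofReal hB
  rw [ENNReal.ofReal_zero] at hB'
  refine tendsto_of_tendsto_of_tendsto_of_le_of_le' tendsto_const_nhds hB'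
    (Eventually.of_forall fun _ => zero_le) ?_
  filter_upwards [h] with n hn
  exact iSup_le fun τ => iSup_le fun θ => ENNReal.ofReal_le_ofReal (hn τ θ)

lemma eventually_one_le_threshold {γ : ℝ} (hγ : 0 < γ) : ∀ᶠ n : ℕ in atTop, 1 ≤ threshold γ n := by
  have : Tendsto (threshold γ) atTop atTop :=
    (Real.tendsto_sqrt_atTop.comp (tendsto_log_natCast.const_mul_atTop two_pos)).const_mul_atTop hγ
  exact this.eventually_ge_atTop 1

lemma bTilde_mem_Icc {b h : ℝ} (hb : 0 < b) (hh : 0 < h) : bTilde b h ∈ Set.Icc (0 : ℝ) 1 := by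
  unfold bTilde
  exact ⟨by positivity, by rw [div_le_one (by positivity)]; linarith⟩

/-- γ and √r are nonnegative with sum below 1/√(4e), and 4e > 10. -/
lemma sq_le_and_ratio_le {γ r : ℝ} (hr : 0 ≤ r)
    (hγ : 0 < γ ∧ γ < 1 / √(4 * Real.exp 1) - √r) : γ ^ 2 ≤ 1 / 10 ∧ r ≤ 1 / 10 := by
  have he : (10 : ℝ) ≤ 4 * Real.exp 1 := by have := Real.exp_one_gt_d9; linarith
  have hs : (1 / √(4 * Real.exp 1)) ^ 2 ≤ 1 / 10 := by
    rw [div_pow, one_pow, Real.sq_sqrt (by positivity)]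
    exact one_div_le_one_div_of_le (by norm_num) he
  have h0 : 0 ≤ √r := Real.sqrt_nonneg r
  constructor
  · refine le_trans ?_ hs
    have := hγ.1
    gcongr
    linarith
  · rw [← Real.sq_sqrt hr]
    refine le_trans ?_ hs
    gcongr
    linarith

end CheckLoss

end

theorem mainTheorem2 (b h σp σf γ : ℕ → ℝ)
    (hb : ∀ i, 0 < b i) (hh : ∀ i, 0 < h i) (hσf : ∀ i, 0 < σf i)
    (hA1 : CheckLoss.BoundedWeights b h)
    (hA3 : CheckLoss.SufficientHistory σp σf)
    (hγ : ∀ i, 0 < γ i ∧ γ i < 1 / √(4 * Real.exp 1) - √(σp i / σf i))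
    (i : ℕ) :
    (∀ (n : ℕ) (τ : ℝ≥0∞) (θ : ℝ),
      MemLp (fun p : ℝ × ℝ => CheckLoss.thresholdEst (γ i) (σp i) (σf i)
        (CheckLoss.bTilde (b i) (h i)) n τ p.1 p.2) 2 (CheckLoss.coordLaw (σp i) θ)) ∧
    Tendsto (fun n : ℕ => ⨆ (τ : ℝ≥0∞) (θ : ℝ), ENNReal.ofReal (CheckLoss.rate n ^ 8 *
        |CheckLoss.bias (γ i) (σp i) (σf i) (CheckLoss.bTilde (b i) (h i)) n τ θ|))
      atTop (𝓝 0) ∧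
    Tendsto (fun n : ℕ => ⨆ (τ : ℝ≥0∞) (θ : ℝ), ENNReal.ofReal ((n : ℝ)⁻¹ *
        CheckLoss.rate n ^ 8 *
        CheckLoss.estVar (γ i) (σp i) (σf i) (CheckLoss.bTilde (b i) (h i)) n τ θ))
      atTop (𝓝 0) := by
  have hσ : 0 < σp i := by
    obtain ⟨m, hm, hmi⟩ := hA3.2.2
    exact hm.trans_le (hmi i)
  have hf := hσf i
  obtain ⟨h0, h1⟩ := CheckLoss.bTilde_mem_Icc (hb i) (hh i)
  obtain ⟨hγ2, hr⟩ := CheckLoss.sq_le_and_ratio_le (div_pos hσ hf).le (hγ i)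
  have hw5 : 2 * σp i / σf i ≤ 1 / 5 := by rw [mul_div_assoc]; linarith
  refine ⟨fun n τ θ => CheckLoss.memLp_thresholdEst hσ h0 h1 _ _ _ _ _, ?_, ?_⟩
  · obtain ⟨K, c, hc, hB⟩ :=
      CheckLoss.abs_bias_le_biasEnvelope hσ hf h0 h1 (hγ i).1 hγ2 hw5
    refine CheckLoss.tendsto_iSup_ofReal
      ((CheckLoss.tendsto_biasEnvelope K hc).comp CheckLoss.tendsto_log_natCast) ?_
    filter_upwards [CheckLoss.eventually_one_le_threshold (hγ i).1] with n hn τ θ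
    exact mul_le_mul_of_nonneg_left (hB n hn τ θ) (Even.pow_nonneg (by decide) _)
  · obtain ⟨K, c, hV⟩ :=
      CheckLoss.estVar_le_varEnvelope hσ hf h0 h1 (hγ i).1 hγ2 hw5
    refine CheckLoss.tendsto_iSup_ofReal
      ((CheckLoss.tendsto_varEnvelope K c).comp CheckLoss.tendsto_log_natCast) ?_
    filter_upwards [eventually_ge_atTop 1] with n hn τ θ
    rw [mul_comm (n : ℝ)⁻¹, mul_assoc]
    exact mul_le_mul_of_nonneg_left (hV n hn τ θ) (Even.pow_nonneg (by decide) _)
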